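/- **Thermodynamics.** For each phase $k\in\{1,2\}$ let a pressure law $p_k(\rho,e)$ and a (mathematical) entropy $s_k(\rho,e)$ be given, and a constant $p_{\infty,k}\ge 0$. On the set $\{\rho>0,\ \rho e>p_{\infty,k}\}$ (all positive $\rho,e$ if $p_{\infty,k}=0$) assume that $p_k$ is $C^1$, that $\mathrm ds_k=\frac1{T_k}\big(\frac{p_k}{\rho^2}\mathrm d\rho-\mathrm de\big)$ with $T_k>0$, that $s_k$ is strictly convex as a function of $(\tau,e)$, $\tau=1/\rho$, and that the set of values of $e\mapsto s_k(\rho,e)$ does not depend on $\rho$. Denote by $s\mapsto e_k(\tau,s)$ the inverse function of $e\mapsto s_k(1/\tau,e)$, and put $\mathcal P_k(\tau,s)=p_k(1/\tau,e_k(\tau,s))$ and $c_k^2=\partial_\rho p_k+\frac{p_k}{\rho^2}\partial_e p_k$. Phase $k$ is a stiffened gas (ideal gas if $p_{\infty,k}=0$) if $p_k=(\gamma_k-1)\rho e-\gamma_kp_{\infty,k}$ for all $\rho,e>0$, with a constant $\gamma_k>1$. **States.** Let $\mathcal U=(\alpha_1,\alpha_k\rho_k,\alpha_k\rho_ku_k,\alpha_k\rho_kE_k)_{k=1,2}\in\mathbb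 R^7$, $\alpha_2=1-\alpha_1$, $e_k=E_k-u_k^2/2$, $\tau_k=1/\rho_k$, and $\Omega_{\mathcal U}=\{0<\alpha_1<1,\ \alpha_k\rho_k>0,\ \alpha_k\rho_ke_k>0,\ k=1,2\}$. Let $(\alpha_k\rho_ks_k)(\mathcal U)=\alpha_k\rho_k\,s_k(\rho_k,e_k)$. Call $\mathcal U\in\Omega_{\mathcal U}$ *admissible for phase $k$* if $\rho_ke_k>p_{\infty,k}$ (automatic if $p_{\infty,k}=0$). For $W=(\alpha_1,\alpha_k\rho_k,\alpha_k\rho_ku_k,\alpha_k\rho_ks_k,\alpha_k\rho_k\mathcal T_k)_{k=1,2}\in\mathbb R^9$ and parameters $a_1,a_2>0$ let $$\pi_k=\mathcal P_k(\mathcal T_k,s_k)+a_k^2(\mathcal T_k-\tau_k),\qquad \mathcal E_k=\tfrac12u_k^2+e_k(\mathcal T_k,s_k)+\frac{\pi_k^2-\mathcal P_k(\mathcal T_k,s_k)^2}{2a_k^2},$$ and $\Omega_W=\{0<\alpha_1<1,\ \alpha_k\rho_k>0,\ \alpha_k\rho_k\mathcal T_k>0\}$. Let $M(\mathcal U)$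 be the vector $W$ with the same $\alpha_k,\alpha_k\rho_k,\alpha_k\rho_ku_k$, with $\alpha_k\rho_ks_k=(\alpha_k\rho_ks_k)(\mathcal U)$ and with $\mathcal T_k=\tau_k$. **Riemann solutions.** A *subsonic solution* between $W_L$ and $W_R$ with parameters $(a_1,a_2)$ is a piecewise constant $\xi\mapsto W_r(\xi)\in\Omega_W$, with at most six jumps, which are contact discontinuities for different ones of the eigenvalues $u_k,\ u_k\pm a_k\tau_k$, together with numbers $u_2^*,\pi_1^*\in\mathbb R$ such that: $W_r(\xi)=W_L$ for $\xi<\min_k(u_{k,L}-a_k\tau_{k,L})$ and $W_r(\xi)=W_R$ for $\xi>\max_k(u_{k,R}+a_k\tau_{k,R})$; for some $Q\ge0$ the function $W_r(x/t)$ satisfies, in the sense of distributions on $\mathbb R\times(0,\infty)$ and for $k=1,2$, with $\Delta\alpha_k=\alpha_{k,R}-\alpha_{k,L}$ and $\delta$ the Dirac measure on $x=u_2^*t$, $$\begin{aligned}&\partial_t\alpha_k+u_2^*\partial_x\alpha_k=0,\qquad \partial_t(\alpha_k\rho_k)+\partial_x(\alpha_k\rho_ku_k)=0,\\ &\partial_t(\alpha_k\rho_ku_k)+\partial_x(\alpha_k\rho_ku_k^2+\alpha_k\pi_k)=\pi_1^*\Delta\alpha_k\,\delta,\\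 &\partial_t(\alpha_k\rho_ks_k)+\partial_x(\alpha_k\rho_ks_ku_k)=0,\qquad \partial_t(\alpha_k\rho_k\mathcal T_k)+\partial_x(\alpha_k\rho_k\mathcal T_ku_k)=0,\\ &\partial_t(\alpha_k\rho_k\mathcal E_k)+\partial_x(\alpha_k\rho_k\mathcal E_ku_k+\alpha_k\pi_ku_k)=u_2^*\pi_1^*\Delta\alpha_k\,\delta-Q\,\delta\,\mathbf 1_{k=1};\end{aligned}$$ and $u_{1,L}-a_1\tau_{1,L}<u_2^*<u_{1,R}+a_1\tau_{1,R}$. **Scheme.** Let $\Delta t,\Delta x>0$. Cell values $\mathcal U_j^n$ ($n\in\mathbb N$, $j\in\mathbb Z$), interface parameters $(a_k)^n_{j+1/2}>0$, and at each interface $j+\frac12$ and time $n$ a profile $W_r$ with numbers $u_2^*,\pi_1^*$ are given with $$\mathcal U_j^{n+1}=\mathcal U_j^n-\tfrac{\Delta t}{\Delta x}\big(\mathcal F^-_{j+1/2}-\mathcal F^+_{j-1/2}\big),$$ where, with $L=j$, $R=j+1$, the components of $\mathcal F^\pm_{j+1/2}$ are: - for $\alpha_1$: $\mathcal F^-=\mathbf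 1_{u_2^*<0}\,u_2^*\Delta\alpha_1$ and $\mathcal F^+=-\mathbf 1_{u_2^*>0}\,u_2^*\Delta\alpha_1$; - for $\alpha_k\rho_k$: $\mathcal F^\pm=(\alpha_k\rho_ku_k)(W_r(0^\pm))$; - for $\alpha_k\rho_ku_k$: $\mathcal F^-=(\alpha_k\rho_ku_k^2+\alpha_k\pi_k)(W_r(0^-))-\mathbf 1_{u_2^*<0}\,\pi_1^*\Delta\alpha_k$ and $\mathcal F^+=(\alpha_k\rho_ku_k^2+\alpha_k\pi_k)(W_r(0^+))+\mathbf 1_{u_2^*>0}\,\pi_1^*\Delta\alpha_k$; - for $\alpha_k\rho_kE_k$: $\mathcal F^-=(\alpha_k\rho_k\mathcal E_ku_k+\alpha_k\pi_ku_k)(W_r(0^+))-\mathbf 1_{u_2^*\le0}\,u_2^*\pi_1^*\Delta\alpha_k$ and $\mathcal F^+=(\alpha_k\rho_k\mathcal E_ku_k+\alpha_k\pi_ku_k)(W_r(0^+))+\mathbf 1_{u_2^*\ge0}\,u_2^*\pi_1^*\Delta\alpha_k$. The *CFL condition* at time $n$ is $\frac{\Delta t}{\Delta x}\max\{|u_{k,j}^n-(a_k)^n_{j+1/2}\tau_{k,j}^n|,\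 |u_{k,j+1}^n+(a_k)^n_{j+1/2}\tau_{k,j+1}^n|\}<\frac12$ for all $j,k$. *Whitham's condition* at time $n$ is: at each interface, for $k=1,2$ and every $\xi$, $\big((a_k)^n_{j+1/2}\big)^2>-\partial_\tau\mathcal P_k(\mathcal T,s_k(\xi))$ for all $\mathcal T$ between $\tau_k(\xi)$ and $\mathcal T_k(\xi)$, where $\tau_k,\mathcal T_k,s_k$ are taken in $W_r$. **Theorem.** Let $n\in\mathbb N$, and suppose that at every interface $W_r$ with $u_2^*,\pi_1^*$ is a subsonic solution between $M(\mathcal U_j^n)$ and $M(\mathcal U_{j+1}^n)$ with the parameters $(a_k)^n_{j+1/2}$. 1. *Positivity.* Suppose that $\mathcal U_j^n\in\Omega_{\mathcal U}$ for all $j$ and that the CFL condition holds at time $n$. Then $0<(\alpha_k)_j^{n+1}<1$ and $(\alpha_k\rho_k)_j^{n+1}>0$ for all $j,k$. If moreover Whitham's condition holds at time $n$ and all $\mathcal U_j^n$ are admissible for both phases, then $(e_k)_j^{n+1}>0$ for all $j,k$; so $\mathcal U_j^{n+1}\in\Omega_{\mathcal U}$, and all $\mathcal U_j^{n+1}$ are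 again admissible for both phases. If phase $k$ is an ideal or stiffened gas, Whitham's condition holds at time $n$, all $\mathcal U_j^n$ are admissible for the other phase, and $c_k^2((\rho_k)_j^n,(e_k)_j^n)>0$ for all $j$, then $c_k^2((\rho_k)_j^{n+1},(e_k)_j^{n+1})>0$ for all $j$. 2. *Conservativity.* The partial masses $\alpha_k\rho_k$ ($k=1,2$), the total momentum $\sum_k\alpha_k\rho_ku_k$ and the total energy $\sum_k\alpha_k\rho_kE_k$ are discretized conservatively: for each of these quantities the two numerical fluxes $\mathcal F^-$ and $\mathcal F^+$ at each interface coincide, and the update is in conservation form with this common flux. 3. *Discrete entropy inequalities.* If all $\mathcal U_j^n$ are in $\Omega_{\mathcal U}$ and admissible for both phases, and the CFL condition and Whitham's condition hold at time $n$, then for $k=1,2$ and all $j$ $$(\alpha_k\rho_ks_k)(\mathcal U_j^{n+1})\le(\alpha_k\rho_ks_k)(\mathcal U_j^n)-\tfrac{\Delta t}{\Delta x}\Big((\alpha_k\rho_ks_ku_k)^n_{j+1/2}-(\alpha_k\rho_ks_ku_k)^n_{j-1/2}\Big),$$ where $(\alpha_k\rho_ks_ku_k)^n_{j+1/2}$ is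 the common value of $\alpha_k\rho_ks_ku_k$ at $W_r(0^-)$ and $W_r(0^+)$. -/

import Mathlib

open MeasureTheory
open scoped ContDiff

noncomputable section

namespace BaerNunziato

/-! ## Thermodynamics of one phase -/

/-- Complete equation of state of one phase. Pressure and (mathematical) entropy are functions of
the density `ρ` and the specific internal energy `e`; they are used on the thermodynamic domain
`ρ > 0`, `ρ e > pInf`, with `pInf ≥ 0`. For `pInf = 0` this is the set of all positive `ρ` and `e`;
a stiffened gas has an entropy only where `ρ e > pInf`. -/
structure PhaseEOS where
  /-- pressure `p(ρ, e)` -/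
  p : ℝ → ℝ → ℝ
  /-- mathematical entropy `s(ρ, e)` -/
  s : ℝ → ℝ → ℝ
  /-- integrating factor (temperature) `T(ρ, e)` -/
  temp : ℝ → ℝ → ℝ
  pInf : ℝ
  pInf_nonneg : 0 ≤ pInf
  p_contDiffOn : ContDiffOn ℝ 1 (fun x : ℝ × ℝ => p x.1 x.2) {x | 0 < x.1 ∧ pInf < x.1 * x.2}
  temp_pos : ∀ ρ e, 0 < ρ → pInf < ρ * e → 0 < temp ρ e
  /-- second principle: `ds = (1 / T) (p / ρ² dρ - de)` -/
  second_law : ∀ ρ e, 0 < ρ → pInf < ρ * e →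
    HasFDerivAt (fun x : ℝ × ℝ => s x.1 x.2)
      ((1 / temp ρ e) •
        ((p ρ e / ρ ^ 2) • ContinuousLinearMap.fst ℝ ℝ ℝ - ContinuousLinearMap.snd ℝ ℝ ℝ)) (ρ, e)
  /-- the entropy is strictly convex in specific volume and specific internal energy -/
  s_strictConvex : StrictConvexOn ℝ {x : ℝ × ℝ | 0 < x.1 ∧ pInf * x.1 < x.2}
    (fun x => s x.1⁻¹ x.2)
  /-- the values of `e ↦ s(ρ, e)` do not depend on `ρ`: the inverse function `e(τ, s)` is defined
  for every `τ > 0` and every entropy value `s` -/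
  s_range : ∀ ρ e ρ', 0 < ρ → pInf < ρ * e → 0 < ρ' →
    ∃ e', pInf < ρ' * e' ∧ s ρ' e' = s ρ e

namespace PhaseEOS

variable (q : PhaseEOS)

open Classical in
/-- `e(τ, s)`, the inverse function of `e ↦ s(1 / τ, e)` on the thermodynamic domain. -/
def energy (τ s : ℝ) : ℝ :=
  if h : ∃ e, q.pInf < τ⁻¹ * e ∧ q.s τ⁻¹ e = s then h.choose else 0

/-- `𝒫(τ, s) = p(1 / τ, e(τ, s))`. -/
def pressure (τ s : ℝ) : ℝ := q.p τ⁻¹ (q.energy τ s)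

/-- `c(ρ, e)² = ∂p/∂ρ + (p / ρ²) ∂p/∂e`. -/
def soundSpeedSq (ρ e : ℝ) : ℝ :=
  deriv (fun r => q.p r e) ρ + q.p ρ e / ρ ^ 2 * deriv (fun x => q.p ρ x) e

/-- Stiffened gas (ideal gas if `pInf = 0`): `p = (γ - 1) ρ e - γ pInf` with `γ > 1`. -/
def IsStiffenedGas : Prop :=
  ∃ γ : ℝ, 1 < γ ∧ ∀ ρ e, 0 < ρ → 0 < e → q.p ρ e = (γ - 1) * ρ * e - γ * q.pInf

end PhaseEOS

/-! ## States -/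

/-- `α_k` in terms of `α₁`, with `α₁ + α₂ = 1`. Phase 1 is `k = 0`, phase 2 is `k = 1`. -/
def frac (α₁ : ℝ) (k : Fin 2) : ℝ := if k = 0 then α₁ else 1 - α₁

/-- Vectors `(α₁, (α_k ρ_k)_k, (α_k ρ_k u_k)_k, (α_k ρ_k E_k)_k)` of `ℝ⁷`; numerical fluxes are
vectors of the same kind. -/
@[ext] structure BNVec where
  vol : ℝ
  mass : Fin 2 → ℝ
  mom : Fin 2 → ℝ
  ener : Fin 2 → ℝ

namespace BNVec

variable (U : BNVec) (k : Fin 2)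

def α : ℝ := frac U.vol k
def ρ : ℝ := U.mass k / U.α k
def u : ℝ := U.mom k / U.mass k
/-- specific internal energy `e_k = E_k - u_k² / 2` -/
def e : ℝ := U.ener k / U.mass k - U.u k ^ 2 / 2

/-- The physical space `Ω_𝒰`. -/
def Omega : Set BNVec :=
  {U | 0 < U.vol ∧ U.vol < 1 ∧ ∀ k, 0 < U.mass k ∧ 0 < U.mass k * U.e k}

/-- `(α_k ρ_k s_k)(𝒰) = α_k ρ_k s_k(ρ_k, e_k)`. -/
def entropy (eos : Fin 2 → PhaseEOS) : ℝ := U.mass k * (eos k).s (U.ρ k) (U.e k)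

/-- `c_k(ρ_k, e_k)²`. -/
def soundSpeedSq (eos : Fin 2 → PhaseEOS) : ℝ := (eos k).soundSpeedSq (U.ρ k) (U.e k)

/-- The finite volume update `U - r (Fm - Fp)`. -/
def update (r : ℝ) (U Fm Fp : BNVec) : BNVec where
  vol := U.vol - r * (Fm.vol - Fp.vol)
  mass k := U.mass k - r * (Fm.mass k - Fp.mass k)
  mom k := U.mom k - r * (Fm.mom k - Fp.mom k)
  ener k := U.ener k - r * (Fm.ener k - Fp.ener k)

end BNVec

/-- Relaxation vectors
`(α₁, (α_k ρ_k)_k, (α_k ρ_k u_k)_k, (α_k ρ_k s_k)_k, (α_k ρ_k 𝒯_k)_k)` of `ℝ⁹`. -/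
@[ext] structure RelaxVec where
  vol : ℝ
  mass : Fin 2 → ℝ
  mom : Fin 2 → ℝ
  ent : Fin 2 → ℝ
  rel : Fin 2 → ℝ

namespace RelaxVec

variable (W : RelaxVec) (k : Fin 2) (eos : Fin 2 → PhaseEOS) (a : Fin 2 → ℝ)

def α : ℝ := frac W.vol k
def τ : ℝ := W.α k / W.mass k
def u : ℝ := W.mom k / W.mass k
def s : ℝ := W.ent k / W.mass k
/-- the relaxation specific volume `𝒯_k` -/
def T : ℝ := W.rel k / W.mass k

/-- The admissible space `Ω_W`. -/
def Omega : Set RelaxVec :=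
  {W | 0 < W.vol ∧ W.vol < 1 ∧ ∀ k, 0 < W.mass k ∧ 0 < W.rel k}

/-- `π_k = 𝒫_k(𝒯_k, s_k) + a_k² (𝒯_k - τ_k)`. -/
def π : ℝ := (eos k).pressure (W.T k) (W.s k) + a k ^ 2 * (W.T k - W.τ k)

/-- `ℰ_k = u_k² / 2 + e_k(𝒯_k, s_k) + (π_k² - 𝒫_k(𝒯_k, s_k)²) / (2 a_k²)`. -/
def relaxEnergy : ℝ :=
  W.u k ^ 2 / 2 + (eos k).energy (W.T k) (W.s k) +
    (W.π k eos a ^ 2 - (eos k).pressure (W.T k) (W.s k) ^ 2) / (2 * a k ^ 2)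

/-- `α_k ρ_k u_k² + α_k π_k`. -/
def momFlux : ℝ := W.mass k * W.u k ^ 2 + W.α k * W.π k eos a

/-- `α_k ρ_k s_k u_k`. -/
def entFlux : ℝ := W.mass k * W.s k * W.u k

/-- `α_k ρ_k ℰ_k u_k + α_k π_k u_k`. -/
def enerFlux : ℝ :=
  W.mass k * W.relaxEnergy k eos a * W.u k + W.α k * W.π k eos a * W.u k

/-- The six distinct eigenvalues `u_k - a_k τ_k`, `u_k`, `u_k + a_k τ_k` of the relaxation system,
indexed by the phase `k` and by `i = 0, 1, 2`. -/
def eigenvalue (f : Fin 2 × Fin 3) : ℝ :=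
  W.u f.1 + (((f.2 : ℕ) : ℝ) - 1) * (a f.1 * W.τ f.1)

end RelaxVec

/-- The equilibrium relaxation vector of `𝒰`: the entropies are `(α_k ρ_k s_k)(𝒰)`, and
`𝒯_k = τ_k`, that is, `α_k ρ_k 𝒯_k = α_k`. -/
def equilibrium (eos : Fin 2 → PhaseEOS) (U : BNVec) : RelaxVec where
  vol := U.vol
  mass := U.mass
  mom := U.mom
  ent k := U.entropy k eos
  rel k := U.α k

/-! ## The relaxation Riemann problem -/

/-- `∂_t f(x/t) + ∂_x g(x/t) = c δ_{x - v t}` on `ℝ × (0, ∞)` in the sense of distributions. -/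
def WeakBalance (f g : ℝ → ℝ) (c v : ℝ) : Prop :=
  ∀ φ : ℝ × ℝ → ℝ, ContDiff ℝ ∞ φ → HasCompactSupport φ → tsupport φ ⊆ {z | 0 < z.2} →
    -(∫ z : ℝ × ℝ, (f (z.1 / z.2) * fderiv ℝ φ z (0, 1) + g (z.1 / z.2) * fderiv ℝ φ z (1, 0))) =
      c * ∫ t : ℝ, φ (v * t, t)

/-- A piecewise constant self-similar profile with at most six discontinuities and seven states
(fewer when speeds or states coincide), with the numbers `u₂*` and `π₁*` attached to it. -/
structure RiemannFan where
  speed : Fin 6 → ℝ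
  state : Fin 7 → RelaxVec
  u2star : ℝ
  pi1star : ℝ

namespace RiemannFan

variable (R : RiemannFan)

open Classical in
/-- The profile `ξ ↦ W_r(ξ)`, taken right continuous; so `W_r(ξ⁺)` is `R.eval ξ`. -/
def eval (ξ : ℝ) : RelaxVec :=
  R.state ⟨(Finset.univ.filter fun i => R.speed i ≤ ξ).card,
    Nat.lt_succ_of_le ((Finset.card_le_univ _).trans (by simp))⟩

open Classical in
/-- The left trace `W_r(ξ⁻)`. -/
def evalLeft (ξ : ℝ) : RelaxVec :=
  R.state ⟨(Finset.univ.filter fun i => R.speed i < ξ).card,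
    Nat.lt_succ_of_le ((Finset.card_le_univ _).trans (by simp))⟩

end RiemannFan

/-- `R` is a solution with subsonic wave ordering of the Riemann problem for the convective part of
the relaxation system with parameters `a`, between `WL` and `WR`. -/
structure IsSubsonicSolution (eos : Fin 2 → PhaseEOS) (a : Fin 2 → ℝ) (WL WR : RelaxVec)
    (R : RiemannFan) : Prop where
  speed_mono : Monotone R.speed
  mem_Omega : ∀ ξ, R.eval ξ ∈ RelaxVec.Omega
  /-- the discontinuities are contact discontinuities for different eigenvalues -/
  contact : ∃ w : Fin 6 → Fin 2 × Fin 3, Function.Injective w ∧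
    ∀ i : Fin 6, R.state i.castSucc ≠ R.state i.succ →
      (R.state i.castSucc).eigenvalue a (w i) = R.speed i ∧
        (R.state i.succ).eigenvalue a (w i) = R.speed i
  left_state : ∀ ξ, (∀ k, WL.u k - a k * WL.τ k > ξ) → R.eval ξ = WL
  right_state : ∀ ξ, (∀ k, WR.u k + a k * WR.τ k < ξ) → R.eval ξ = WR
  vol_eq : ∀ k, WeakBalance (fun ξ => (R.eval ξ).α k) (fun ξ => R.u2star * (R.eval ξ).α k) 0 0
  mass_eq : ∀ k, WeakBalance (fun ξ => (R.eval ξ).mass k)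
    (fun ξ => (R.eval ξ).mass k * (R.eval ξ).u k) 0 0
  mom_eq : ∀ k, WeakBalance (fun ξ => (R.eval ξ).mass k * (R.eval ξ).u k)
    (fun ξ => (R.eval ξ).momFlux k eos a) (R.pi1star * (WR.α k - WL.α k)) R.u2star
  ent_eq : ∀ k, WeakBalance (fun ξ => (R.eval ξ).mass k * (R.eval ξ).s k)
    (fun ξ => (R.eval ξ).entFlux k) 0 0
  rel_eq : ∀ k, WeakBalance (fun ξ => (R.eval ξ).mass k * (R.eval ξ).T k)
    (fun ξ => (R.eval ξ).mass k * (R.eval ξ).T k * (R.eval ξ).u k) 0 0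
  /-- energy of phase 2 -/
  ener2_eq : WeakBalance (fun ξ => (R.eval ξ).mass 1 * (R.eval ξ).relaxEnergy 1 eos a)
    (fun ξ => (R.eval ξ).enerFlux 1 eos a)
    (R.u2star * R.pi1star * (WR.α 1 - WL.α 1)) R.u2star
  /-- energy of phase 1, with a dissipation `Q ≥ 0` on the line `x = u₂* t` -/
  ener1_eq : ∃ Q : ℝ, 0 ≤ Q ∧
    WeakBalance (fun ξ => (R.eval ξ).mass 0 * (R.eval ξ).relaxEnergy 0 eos a)
      (fun ξ => (R.eval ξ).enerFlux 0 eos a)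
      (R.u2star * R.pi1star * (WR.α 0 - WL.α 0) - Q) R.u2star
  subsonic_left : WL.u 0 - a 0 * WL.τ 0 < R.u2star
  subsonic_right : R.u2star < WR.u 0 + a 0 * WR.τ 0

/-- Whitham's condition along the solution `R`: `a_k² > -∂_τ 𝒫_k(𝒯, s_k)` for the entropies `s_k` of
the solution and for all `𝒯` between the specific volume `τ_k` and the relaxation specific volume
`𝒯_k` of the solution at the same point. -/
def Whitham (eos : Fin 2 → PhaseEOS) (a : Fin 2 → ℝ) (R : RiemannFan) : Prop :=
  ∀ (k : Fin 2) (ξ : ℝ), ∀ T ∈ Set.uIcc ((R.eval ξ).τ k) ((R.eval ξ).T k),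
    -(deriv (fun τ => (eos k).pressure τ ((R.eval ξ).s k)) T) < a k ^ 2

/-! ## The scheme -/

/-- The flux `ℱ⁻(UL, UR)`, seen from the cell on the left of the interface. -/
def fluxMinus (eos : Fin 2 → PhaseEOS) (a : Fin 2 → ℝ) (R : RiemannFan) (UL UR : BNVec) :
    BNVec where
  vol := if R.u2star < 0 then R.u2star * (UR.vol - UL.vol) else 0
  mass k := (R.evalLeft 0).mass k * (R.evalLeft 0).u k
  mom k := (R.evalLeft 0).momFlux k eos a
    - if R.u2star < 0 then R.pi1star * (UR.α k - UL.α k) else 0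
  ener k := (R.eval 0).enerFlux k eos a
    - if R.u2star ≤ 0 then R.u2star * R.pi1star * (UR.α k - UL.α k) else 0

/-- The flux `ℱ⁺(UL, UR)`, seen from the cell on the right of the interface. -/
def fluxPlus (eos : Fin 2 → PhaseEOS) (a : Fin 2 → ℝ) (R : RiemannFan) (UL UR : BNVec) :
    BNVec where
  vol := - if 0 < R.u2star then R.u2star * (UR.vol - UL.vol) else 0
  mass k := (R.eval 0).mass k * (R.eval 0).u k
  mom k := (R.eval 0).momFlux k eos a
    + if 0 < R.u2star then R.pi1star * (UR.α k - UL.α k) else 0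
  ener k := (R.eval 0).enerFlux k eos a
    + if 0 ≤ R.u2star then R.u2star * R.pi1star * (UR.α k - UL.α k) else 0

/-- The finite volume scheme. The index `j` of `a` and `R` stands for the interface between the
cells `j` and `j + 1`; `U n j` is the state of the cell `j` at time `n Δt`. -/
def IsScheme (eos : Fin 2 → PhaseEOS) (Δt Δx : ℝ) (a : ℕ → ℤ → Fin 2 → ℝ)
    (R : ℕ → ℤ → RiemannFan) (U : ℕ → ℤ → BNVec) : Prop :=
  ∀ n j, U (n + 1) j = BNVec.update (Δt / Δx) (U n j)
    (fluxMinus eos (a n j) (R n j) (U n j) (U n (j + 1)))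
    (fluxPlus eos (a n (j - 1)) (R n (j - 1)) (U n (j - 1)) (U n j))

/-- The CFL condition for the cell values `U` and the parameters `a` at one time step. -/
def CFL (Δt Δx : ℝ) (a : ℤ → Fin 2 → ℝ) (U : ℤ → BNVec) : Prop :=
  ∀ (k : Fin 2) (j : ℤ),
    Δt / Δx * max |(U j).u k - a j k * ((U j).ρ k)⁻¹|
      |(U (j + 1)).u k + a j k * ((U (j + 1)).ρ k)⁻¹| < 1 / 2

/-- The quantity `q` is updated to `q'` in conservative form, with one flux per interface. -/
def IsConservativeUpdate (r : ℝ) (q q' Fm Fp : ℤ → ℝ) : Prop :=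
  (∀ j, Fm j = Fp j) ∧ ∀ j, q' j = q j - r * (Fm j - Fm (j - 1))

end BaerNunziato

end

open MeasureTheory
open scoped ContDiff

noncomputable section

namespace BaerNunziato

/-! ## Self-similar weak solutions in one dimension -/

/-! The scheme is Godunov's method applied to the relaxation system. Under the CFL condition the
fans from the two interfaces of a cell do not interact inside it. The new fractions, masses and
momenta are therefore exactly the cell averages of these quantities over the two fans
(`cellMean_eq`), and positivity of fractions and masses is positivity of an average. For the energy
the fluxes omit the sink `Q ≥ 0`, so the new energy is at least the average (`CellStep.le_ener`).

The remaining bounds come from `CellStep.admissible_and_entropy`, one phase at a time. In a fan the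
entropy of a phase takes only its two initial values (`IsSubsonicSolution.s_eval`), so `e(τ, s)` is
meaningful there, and Whitham's condition gives `ℰ ≥ u² / 2 + e(τ, s)` (`RelaxVec.le_relaxEnergy`).
By convexity of the square, the new internal energy is at least the mass-weighted mean `e` of `e(τ,
s)`. Jensen's inequality for the convex entropy at the mean `(τ, e)`, together with the decrease of
`s` in the energy, is the entropy inequality. Admissibility, written as `α ρ e - pInf α > 0`, is
linear in the averaged quantities and so survives averaging; for a stiffened gas it is equivalent to
`c² > 0`.

Two tools support this. `WeakBalance.integrated` turns the distributional equations into balances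
between two speeds, without enumerating waves. `IsEntropyValue.hasDerivAt_energy` gives `∂e/∂τ = -𝒫`
at fixed entropy from convexity alone. Conservativity holds because `α₁ + α₂ = 1` makes the
interface terms of the two phases opposite. -/

lemma contDiff_radial {ψ θ : ℝ → ℝ} (hψ : ContDiff ℝ ∞ ψ) (hθ : ContDiff ℝ ∞ θ)
    (hθ0 : ∀ t < 1, θ t = 0) : ContDiff ℝ ∞ (fun z : ℝ × ℝ => ψ (z.1 / z.2) * θ z.2) := by
  rw [contDiff_iff_contDiffAt]
  intro z
  rcases lt_or_ge z.2 1 with hz | hz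
  · have : (fun z : ℝ × ℝ => ψ (z.1 / z.2) * θ z.2) =ᶠ[nhds z] fun _ => 0 := by
      filter_upwards [(isOpen_Iio.preimage continuous_snd).mem_nhds hz] with y hy
      rw [hθ0 _ hy, mul_zero]
    exact contDiffAt_const.congr_of_eventuallyEq this
  · have h0 : z.2 ≠ 0 := by positivity
    exact (hψ.contDiffAt.comp z (contDiffAt_fst.div contDiffAt_snd h0)).mul
      (hθ.contDiffAt.comp z contDiffAt_snd)

lemma fderiv_radial {ψ θ : ℝ → ℝ} (hψ : ContDiff ℝ ∞ ψ) (hθ : ContDiff ℝ ∞ θ)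
    (hθ0 : ∀ t < 1, θ t = 0) (x : ℝ) {t : ℝ} (ht : t ≠ 0) :
    fderiv ℝ (fun z : ℝ × ℝ => ψ (z.1 / z.2) * θ z.2) (x, t) (1, 0) =
        deriv ψ (x / t) * (1 / t) * θ t ∧
      fderiv ℝ (fun z : ℝ × ℝ => ψ (z.1 / z.2) * θ z.2) (x, t) (0, 1) =
        deriv ψ (x / t) * (-x / t ^ 2) * θ t + ψ (x / t) * deriv θ t := by
  have hd : HasFDerivAt (fun z : ℝ × ℝ => ψ (z.1 / z.2) * θ z.2) _ (x, t) :=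
    ((contDiff_radial hψ hθ hθ0).differentiable (by simp) (x, t)).hasFDerivAt
  have hψd : ∀ y, HasDerivAt ψ (deriv ψ y) y := fun y =>
    (hψ.differentiable (by simp) y).hasDerivAt
  have hθd : ∀ y, HasDerivAt θ (deriv θ y) y := fun y =>
    (hθ.differentiable (by simp) y).hasDerivAt
  constructor
  · have h1 : HasDerivAt (fun y : ℝ => (y, t)) ((1 : ℝ), (0 : ℝ)) x :=
      (hasDerivAt_id x).prodMk (hasDerivAt_const x t)
    have h2 := hd.comp_hasDerivAt x h1
    have h3 : HasDerivAt (fun y => ψ (y / t) * θ t) (deriv ψ (x / t) * (1 / t) * θ t) x :=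
      ((hψd _).comp x ((hasDerivAt_id x).div_const t)).mul_const _
    exact h2.unique h3
  · have h1 : HasDerivAt (fun y : ℝ => (x, y)) ((0 : ℝ), (1 : ℝ)) t :=
      (hasDerivAt_const t x).prodMk (hasDerivAt_id t)
    have h2 := hd.comp_hasDerivAt t h1
    have h4 : HasDerivAt (fun y => x / y) (-x / t ^ 2) t := by
      simpa using (hasDerivAt_const t x).fun_div (hasDerivAt_id' t) ht
    exact h2.unique (((hψd _).comp t h4).mul (hθd t))

lemma integrable_mul_of_bounded {X : Type*} [TopologicalSpace X] [MeasurableSpace X]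
    [OpensMeasurableSpace X] {μ : Measure X} [IsFiniteMeasureOnCompacts μ] {f ψ : X → ℝ}
    (hf : Measurable f) (hfb : ∃ C, ∀ x, |f x| ≤ C) (hψ : Continuous ψ)
    (hψc : HasCompactSupport ψ) : Integrable (fun x => f x * ψ x) μ := by
  obtain ⟨C, hC⟩ := hfb
  exact (hψ.integrable_of_hasCompactSupport hψc).bdd_mul hf.aestronglyMeasurable
    (Filter.Eventually.of_forall hC)

/-- A self-similar weak solution of `∂_t f + ∂_x g = c δ_{x = v t}` satisfies
`(g - ξ f)' + f = c δ_v` on the line. -/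
lemma WeakBalance.radial {f g : ℝ → ℝ} {c v : ℝ} (h : WeakBalance f g c v)
    (hf : Measurable f) (hfb : ∃ C, ∀ x, |f x| ≤ C)
    (hg : Measurable g) (hgb : ∃ C, ∀ x, |g x| ≤ C)
    {ψ : ℝ → ℝ} (hψ : ContDiff ℝ ∞ ψ) (hψc : HasCompactSupport ψ) :
    ∫ ξ, (f ξ * ψ ξ - (g ξ - ξ * f ξ) * deriv ψ ξ) = c * ψ v := by
  -- The test function is `ψ(x / t) θ(t)`. The bump `θ` lives on `[1, 3]`, away from the singularity
  -- of `x / t`. After the substitution `x = t ξ` both sides are multiples of `∫ θ > 0`, which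
  -- cancels.
  let θ : ContDiffBump (2 : ℝ) := ⟨1 / 2, 1, by norm_num, by norm_num⟩
  have hθ : ContDiff ℝ ∞ θ := θ.contDiff
  have hθ0 : ∀ t : ℝ, t < 1 → θ t = 0 := fun t ht => θ.zero_of_le_dist (by
    rw [Real.dist_eq, abs_sub_comm]; exact (show (1 : ℝ) ≤ 2 - t by linarith).trans (le_abs_self _))
  have hθ3 : ∀ t : ℝ, 3 < t → θ t = 0 := fun t ht => θ.zero_of_le_dist (by
    rw [Real.dist_eq]; exact (show (1 : ℝ) ≤ t - 2 by linarith).trans (le_abs_self _))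
  have hθc : HasCompactSupport θ := θ.hasCompactSupport
  have hI : (0 : ℝ) < ∫ t, θ t := θ.integral_pos
  set φ : ℝ × ℝ → ℝ := fun z => ψ (z.1 / z.2) * θ z.2 with hφdef
  have hφ : ContDiff ℝ ∞ φ := contDiff_radial hψ hθ hθ0
  let K : Set (ℝ × ℝ) := (fun y : ℝ × ℝ => (y.1 * y.2, y.2)) '' (tsupport ψ ×ˢ Set.Icc 1 3)
  have hK : IsCompact K := (hψc.isCompact.prod isCompact_Icc).image (by fun_prop)
  have hφK : ∀ z ∉ K, φ z = 0 := by
    intro z hz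
    by_contra hne
    have h1 : ψ (z.1 / z.2) ≠ 0 := left_ne_zero_of_mul hne
    have h2 : θ z.2 ≠ 0 := right_ne_zero_of_mul hne
    have h3 : 1 ≤ z.2 := not_lt.1 fun h' => h2 (hθ0 _ h')
    have h4 : z.2 ≤ 3 := not_lt.1 fun h' => h2 (hθ3 _ h')
    refine hz ⟨(z.1 / z.2, z.2), ⟨subset_tsupport _ h1, h3, h4⟩, ?_⟩
    ext
    · exact div_mul_cancel₀ _ (by positivity)
    · rfl
  have hφc : HasCompactSupport φ := HasCompactSupport.intro hK hφK
  have hsub : tsupport φ ⊆ {z | 0 < z.2} := by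
    refine (closure_minimal (fun z (hz : φ z ≠ 0) => by_contra fun h' => hz (hφK z h'))
      hK.isClosed).trans ?_
    rintro _ ⟨y, hy, rfl⟩
    exact lt_of_lt_of_le one_pos hy.2.1
  have key := h φ hφ hφc hsub
  have hfd : Continuous (fderiv ℝ φ) := hφ.continuous_fderiv (by simp)
  have hfdc : HasCompactSupport (fderiv ℝ φ) := hφc.fderiv ℝ
  have hint : ∀ (k : ℝ → ℝ), Measurable k → (∃ C, ∀ x, |k x| ≤ C) → ∀ w : ℝ × ℝ,
      Integrable (fun z : ℝ × ℝ => k (z.1 / z.2) * fderiv ℝ φ z w) := by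
    intro k hk hkb w
    refine integrable_mul_of_bounded (hk.comp (measurable_fst.div measurable_snd))
      (hkb.imp fun C hC x => hC _) (hfd.clm_apply continuous_const) ?_
    exact hfdc.comp_left (g := fun L : ℝ × ℝ →L[ℝ] ℝ => L w) rfl
  have hint2 := (hint f hf hfb (0, 1)).add (hint g hg hgb (1, 0))
  have hψ' : Continuous (deriv ψ) := hψ.continuous_deriv (by simp)
  have hi1 : Integrable fun ξ => f ξ * ψ ξ := integrable_mul_of_bounded hf hfb hψ.continuous hψc
  have hi2 : Integrable fun ξ => (g ξ - ξ * f ξ) * deriv ψ ξ := by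
    have e1 : Integrable fun ξ => g ξ * deriv ψ ξ := integrable_mul_of_bounded hg hgb hψ' hψc.deriv
    have e2 : Integrable fun ξ => f ξ * (ξ * deriv ψ ξ) :=
      integrable_mul_of_bounded hf hfb (continuous_id.mul hψ') hψc.deriv.mul_left
    refine (e1.sub e2).congr (Filter.Eventually.of_forall fun ξ => ?_)
    simp only [Pi.sub_apply]; ring
  set K1 := ∫ ξ, (g ξ - ξ * f ξ) * deriv ψ ξ
  set K2 := ∫ ξ, f ξ * ψ ξ
  have inner : ∀ t : ℝ, t ≠ 0 → (∫ x, (f (x / t) * fderiv ℝ φ (x, t) (0, 1) +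
      g (x / t) * fderiv ℝ φ (x, t) (1, 0))) = K1 * θ t + K2 * (t * deriv θ t) := by
    intro t ht
    rcases lt_or_gt_of_ne ht with ht' | ht'
    · have h0 : θ t = 0 := hθ0 t (by linarith)
      have h1 : deriv θ t = 0 := by
        have : (θ : ℝ → ℝ) =ᶠ[nhds t] fun _ => 0 := by
          filter_upwards [Iio_mem_nhds (show t < 1 by linarith)] with y hy using hθ0 y hy
        rw [this.deriv_eq, deriv_const]
      have : ∀ x, (f (x / t) * fderiv ℝ φ (x, t) (0, 1) +
          g (x / t) * fderiv ℝ φ (x, t) (1, 0)) = 0 := by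
        intro x
        obtain ⟨e1, e2⟩ := fderiv_radial hψ hθ hθ0 x ht
        rw [e1, e2, h0, h1]; ring
      simp [this, h0, h1]
    · have : ∀ x, (f (x / t) * fderiv ℝ φ (x, t) (0, 1) +
          g (x / t) * fderiv ℝ φ (x, t) (1, 0)) =
          (fun ξ => θ t / t * ((g ξ - ξ * f ξ) * deriv ψ ξ) + deriv θ t * (f ξ * ψ ξ))
            (x * t⁻¹) := by
        intro x
        obtain ⟨e1, e2⟩ := fderiv_radial hψ hθ hθ0 x ht
        rw [e1, e2, ← div_eq_mul_inv]
        field_simp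
        ring
      refine (integral_congr_ae (Filter.Eventually.of_forall this)).trans ?_
      rw [Measure.integral_comp_mul_right (fun ξ => θ t / t * ((g ξ - ξ * f ξ) * deriv ψ ξ) +
        deriv θ t * (f ξ * ψ ξ)) t⁻¹, integral_add (hi2.const_mul _)
        (hi1.const_mul _), integral_const_mul, integral_const_mul, inv_inv, abs_of_pos ht']
      rw [smul_eq_mul]
      change t * (θ t / t * K1 + deriv θ t * K2) = _
      field_simp
  have hθ' : Continuous (deriv θ) := hθ.continuous_deriv (by simp)
  have hi3 : Integrable fun t => t * deriv θ t :=
    (continuous_id.mul hθ').integrable_of_hasCompactSupport hθc.deriv.mul_left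
  -- Integration by parts in time is what produces the zeroth-order term `f` of the radial equation.
  have hθp : ∫ t, t * deriv θ t = -∫ t, θ t := by
    have := integral_mul_deriv_eq_deriv_mul_of_integrable (u := fun t : ℝ => t) (v := θ)
      (u' := fun _ => 1) (v' := deriv θ) (fun x _ => hasDerivAt_id x)
      (fun x _ => (hθ.differentiable (by simp) x).hasDerivAt)
      hi3
      ((continuous_const.mul hθ.continuous).integrable_of_hasCompactSupport hθc.mul_left)
      ((continuous_id.mul hθ.continuous).integrable_of_hasCompactSupport hθc.mul_left)
    simpa using this
  have hlhs : ∫ z : ℝ × ℝ, (f (z.1 / z.2) * fderiv ℝ φ z (0, 1) +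
      g (z.1 / z.2) * fderiv ℝ φ z (1, 0)) = (K1 - K2) * ∫ t, θ t := by
    rw [Measure.volume_eq_prod] at hint2 ⊢
    refine (integral_prod_symm _ hint2).trans ?_
    have : (fun t => ∫ x, (f (x / t) * fderiv ℝ φ (x, t) (0, 1) +
        g (x / t) * fderiv ℝ φ (x, t) (1, 0))) =ᵐ[volume]
        fun t => K1 * θ t + K2 * (t * deriv θ t) := by
      have hne : ∀ᵐ t : ℝ, t ≠ 0 := by simp [ae_iff]
      filter_upwards [hne] with t ht using inner t ht
    refine (integral_congr_ae this).trans ?_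
    rw [integral_add ((hθ.continuous.integrable_of_hasCompactSupport hθc).const_mul _)
      (hi3.const_mul _),
      integral_const_mul, integral_const_mul, hθp]
    ring
  have hrhs : ∫ t : ℝ, φ (v * t, t) = ψ v * ∫ t, θ t := by
    rw [← integral_const_mul]
    refine integral_congr_ae (Filter.Eventually.of_forall fun t => ?_)
    rcases eq_or_ne t 0 with rfl | ht
    · simp [hφdef, hθ0 0 one_pos]
    · simp [hφdef, ht]
  rw [hlhs, hrhs] at key
  rw [integral_sub hi1 hi2]
  refine mul_right_cancel₀ hI.ne' ?_
  linear_combination key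

/-- Rankine--Hugoniot relation integrated over an interval of speeds. -/
lemma WeakBalance.integrated {f g : ℝ → ℝ} {c v : ℝ} (h : WeakBalance f g c v)
    (hf : Measurable f) (hfb : ∃ C, ∀ x, |f x| ≤ C)
    (hg : Measurable g) (hgb : ∃ C, ∀ x, |g x| ≤ C)
    (hr : ∀ A, ∀ᶠ x in nhdsWithin A (Set.Ici A), f x = f A ∧ g x = g A) {A B : ℝ} (hAB : A < B) :
    g B - B * f B - (g A - A * f A) =
      -(∫ ξ in A..B, f ξ) + if A < v ∧ v ≤ B then c else 0 := by
  obtain ⟨A', hA', hA⟩ := mem_nhdsGE_iff_exists_Icc_subset.1 (hr A)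
  obtain ⟨B', hB', hB⟩ := mem_nhdsGE_iff_exists_Icc_subset.1 (hr B)
  -- `ε` is so small that `f` and `g` are constant on `[A, A + ε]` and `[B, B + ε]`, and that `v`
  -- lies in the interior of neither interval.
  obtain ⟨ε, hε, h1, h2, h3, h4, h5⟩ : ∃ ε > 0, A + ε ≤ A' ∧ B + ε ≤ B' ∧ A + ε ≤ B ∧
      (A < v → A + ε ≤ v) ∧ (B < v → B + ε ≤ v) := by
    have e1 : ∃ d > 0, A < v → A + d ≤ v := by
      by_cases hv : A < v
      · exact ⟨v - A, by linarith, fun _ => by linarith⟩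
      · exact ⟨1, one_pos, fun h => absurd h hv⟩
    have e2 : ∃ d > 0, B < v → B + d ≤ v := by
      by_cases hv : B < v
      · exact ⟨v - B, by linarith, fun _ => by linarith⟩
      · exact ⟨1, one_pos, fun h => absurd h hv⟩
    obtain ⟨d, hd, hd'⟩ := e1
    obtain ⟨d₂, hd₂, hd₂'⟩ := e2
    refine ⟨min (min (min (A' - A) (B' - B)) (B - A)) (min d d₂), ?_, ?_⟩
    · simp only [gt_iff_lt, lt_min_iff]
      exact ⟨⟨⟨by linarith, by linarith⟩, by linarith⟩, hd, hd₂⟩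
    · set ε := min (min (min (A' - A) (B' - B)) (B - A)) (min d d₂)
      have l1 : ε ≤ min (min (A' - A) (B' - B)) (B - A) := min_le_left _ _
      have l2 : ε ≤ min d d₂ := min_le_right _ _
      simp only [le_min_iff] at l1 l2
      exact ⟨by linarith, by linarith, by linarith, fun hv => by linarith [hd' hv],
        fun hv => by linarith [hd₂' hv]⟩
  -- `S C` rises smoothly from 0 at `C` to 1 at `C + ε`, so `S A - S B` is a smoothed indicator of
  -- `(A, B]`. The ramps lie to the right of `A` and `B` because the profiles are right continuous.
  let S : ℝ → ℝ → ℝ := fun C ξ => Real.smoothTransition ((ξ - C) / ε)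
  have hS : ∀ C, ContDiff ℝ ∞ (S C) := fun C =>
    Real.smoothTransition.contDiff.comp ((contDiff_id.sub contDiff_const).div_const _)
  have hSd : ∀ C x, HasDerivAt (S C) (deriv (S C) x) x := fun C x =>
    ((hS C).differentiable (by simp) x).hasDerivAt
  have hS0 : ∀ C ξ, ξ ≤ C → S C ξ = 0 := fun C ξ hξ =>
    Real.smoothTransition.zero_of_nonpos (div_nonpos_of_nonpos_of_nonneg (by linarith) hε.le)
  have hS1 : ∀ C ξ, C + ε ≤ ξ → S C ξ = 1 := fun C ξ hξ =>
    Real.smoothTransition.one_of_one_le ((one_le_div hε).2 (by linarith))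
  let ψ : ℝ → ℝ := fun ξ => S A ξ - S B ξ
  have hψ : ContDiff ℝ ∞ ψ := (hS A).sub (hS B)
  have hψo : ∀ ξ, ξ ∉ Set.Ioc A (B + ε) → ψ ξ = 0 := by
    intro ξ hξ
    rcases le_or_gt ξ A with h' | h'
    · simp only [ψ]; rw [hS0 A ξ h', hS0 B ξ (by linarith), sub_zero]
    · have : B + ε < ξ := by by_contra h''; exact hξ ⟨h', not_lt.1 h''⟩
      simp only [ψ]; rw [hS1 A ξ (by linarith), hS1 B ξ this.le, sub_self]
  have hψc : HasCompactSupport ψ := HasCompactSupport.intro (isCompact_Icc (a := A) (b := B + ε))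
    fun x hx => hψo x fun h' => hx (Set.Ioc_subset_Icc_self h')
  have key := h.radial hf hfb hg hgb hψ hψc
  have hψv : ψ v = if A < v ∧ v ≤ B then 1 else 0 := by
    split_ifs with hv
    · simp only [ψ]; rw [hS1 A v (h4 hv.1), hS0 B v hv.2, sub_zero]
    · rcases le_or_gt v A with h' | h'
      · exact hψo v fun h'' => absurd h''.1 (not_lt.2 h')
      · have h'' : B < v := by by_contra h3; exact hv ⟨h', not_lt.1 h3⟩
        simp only [ψ]; rw [hS1 A v (h4 h'), hS1 B v (h5 h''), sub_self]
  set F : ℝ → ℝ := fun ξ => f ξ * ψ ξ - (g ξ - ξ * f ξ) * deriv ψ ξ with hF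
  have hψ' : Continuous (deriv ψ) := hψ.continuous_deriv (by simp)
  have hFi : Integrable F := by
    have e0 : Integrable fun ξ => f ξ * ψ ξ := integrable_mul_of_bounded hf hfb hψ.continuous hψc
    have e1 : Integrable fun ξ => g ξ * deriv ψ ξ := integrable_mul_of_bounded hg hgb hψ' hψc.deriv
    have e2 : Integrable fun ξ => f ξ * (ξ * deriv ψ ξ) :=
      integrable_mul_of_bounded hf hfb (continuous_id.mul hψ') hψc.deriv.mul_left
    refine ((e0.sub e1).add e2).congr (Filter.Eventually.of_forall fun ξ => ?_)
    simp only [Pi.sub_apply, Pi.add_apply, hF]; ring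
  have hdψ : ∀ ξ, deriv ψ ξ = deriv (S A) ξ - deriv (S B) ξ := fun ξ =>
    ((hSd A ξ).sub (hSd B ξ)).deriv
  have hdS0 : ∀ C ξ, ξ < C → deriv (S C) ξ = 0 := fun C ξ hξ => by
    have : S C =ᶠ[nhds ξ] fun _ => 0 := by
      filter_upwards [Iio_mem_nhds hξ] with y hy using hS0 C y (le_of_lt hy)
    rw [this.deriv_eq, deriv_const]
  have hdS1 : ∀ C ξ, C + ε < ξ → deriv (S C) ξ = 0 := fun C ξ hξ => by
    have : S C =ᶠ[nhds ξ] fun _ => 1 := by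
      filter_upwards [Ioi_mem_nhds hξ] with y hy using hS1 C y (le_of_lt hy)
    rw [this.deriv_eq, deriv_const]
  have hcont : ∀ C, Continuous (deriv (S C)) := fun C => (hS C).continuous_deriv (by simp)
  have htot : ∫ ξ, F ξ = ∫ ξ in A..(B + ε), F ξ := by
    rw [intervalIntegral.integral_of_le (by linarith)]
    refine (setIntegral_eq_integral_of_forall_compl_eq_zero fun x hx => ?_).symm
    have hd0 : deriv ψ x = 0 := by
      rcases le_or_gt x A with h' | h'
      · rcases h'.lt_or_eq with h'' | rfl
        · rw [hdψ, hdS0 _ _ h'', hdS0 _ _ (by linarith), sub_zero]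
        -- The left endpoint lies outside `Ioc`; there the derivative vanishes because the
        -- nonnegative `ψ` attains the value 0.
        · have hmin : IsLocalMin ψ x := by
            filter_upwards [Iio_mem_nhds (show x < B by linarith)] with y hy
            rw [hψo x (fun h => lt_irrefl _ h.1)]
            simp only [ψ]; rw [hS0 B y (le_of_lt hy), sub_zero]
            exact Real.smoothTransition.nonneg _
          exact hmin.deriv_eq_zero
      · have : B + ε < x := by by_contra h''; exact hx ⟨h', not_lt.1 h''⟩
        rw [hdψ, hdS1 _ _ this, hdS1 _ _ (by linarith), sub_zero]
    simp only [hF]; rw [hψo x hx, hd0]; ring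
  have hsplit : ∫ ξ in A..(B + ε), F ξ = (∫ ξ in A..(A + ε), F ξ) + (∫ ξ in (A + ε)..B, F ξ) +
      ∫ ξ in B..(B + ε), F ξ := by
    rw [intervalIntegral.integral_add_adjacent_intervals hFi.intervalIntegrable
      hFi.intervalIntegrable, intervalIntegral.integral_add_adjacent_intervals
      hFi.intervalIntegrable hFi.intervalIntegrable]
  -- On a ramp `f` and `g` are constants, so the integrand is an exact derivative and the shape of
  -- the ramp does not matter.
  have p1 : ∫ ξ in A..(A + ε), F ξ = -(g A - (A + ε) * f A) := by
    have e : ∫ ξ in A..(A + ε), F ξ =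
        ∫ ξ in A..(A + ε), (f A * S A ξ - (g A - ξ * f A) * deriv (S A) ξ) := by
      refine intervalIntegral.integral_congr_Ioo_of_le (by linarith) fun ξ hξ => ?_
      obtain ⟨q1, q2⟩ := hA ⟨hξ.1.le, hξ.2.le.trans h1⟩
      simp only [hF, ψ]; rw [q1, q2]
      have := hdψ ξ
      simp only [ψ] at this
      rw [this, hS0 B ξ (by linarith [hξ.2]), hdS0 B ξ (by linarith [hξ.2])]; ring
    rw [e, intervalIntegral.integral_eq_sub_of_hasDerivAt (f := fun ξ => -((g A - ξ * f A) * S A ξ))]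
    · rw [hS0 A A le_rfl, hS1 A _ le_rfl]; ring
    · intro x _
      have := ((((hasDerivAt_id x).mul_const (f A)).const_sub (g A)).mul (hSd A x)).neg
      refine this.congr_deriv ?_
      simp only [id]; ring
    · have := hcont A
      have := (hS A).continuous
      exact Continuous.intervalIntegrable (by fun_prop) _ _
  have p2 : ∫ ξ in (A + ε)..B, F ξ = ∫ ξ in (A + ε)..B, f ξ := by
    refine intervalIntegral.integral_congr_Ioo_of_le h3 fun ξ hξ => ?_
    simp only [hF]
    rw [hdψ, hdS1 A ξ hξ.1, hdS0 B ξ hξ.2]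
    simp only [ψ]
    rw [hS1 A ξ hξ.1.le, hS0 B ξ hξ.2.le]; ring
  have p3 : ∫ ξ in B..(B + ε), F ξ = g B - B * f B := by
    have e : ∫ ξ in B..(B + ε), F ξ =
        ∫ ξ in B..(B + ε), (f B * (1 - S B ξ) + (g B - ξ * f B) * deriv (S B) ξ) := by
      refine intervalIntegral.integral_congr_Ioo_of_le (by linarith) fun ξ hξ => ?_
      obtain ⟨q1, q2⟩ := hB ⟨hξ.1.le, hξ.2.le.trans h2⟩
      simp only [hF]; rw [q1, q2, hdψ, hdS1 A ξ (by linarith [hξ.1])]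
      simp only [ψ]; rw [hS1 A ξ (by linarith [hξ.1])]; ring
    rw [e, intervalIntegral.integral_eq_sub_of_hasDerivAt
      (f := fun ξ => -((g B - ξ * f B) * (1 - S B ξ)))]
    · rw [hS0 B B le_rfl, hS1 B _ le_rfl]; ring
    · intro x _
      have := ((((hasDerivAt_id x).mul_const (f B)).const_sub (g B)).mul ((hSd B x).const_sub 1)).neg
      refine this.congr_deriv ?_
      simp only [id]; ring
    · have := hcont B
      have := (hS B).continuous
      exact Continuous.intervalIntegrable (by fun_prop) _ _
  have hfi : ∀ a b, IntervalIntegrable f volume a b := by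
    obtain ⟨C, hC⟩ := hfb
    exact fun a b => (intervalIntegrable_const (c := C)).mono_fun hf.aestronglyMeasurable
      (Filter.Eventually.of_forall fun x => by
        simpa using (hC x).trans (le_abs_self C))
  have p4 : ∫ ξ in A..(A + ε), f ξ = ε * f A := by
    rw [intervalIntegral.integral_congr_Ioo_of_le (g := fun _ => f A) (by linarith)
      fun ξ hξ => (hA ⟨hξ.1.le, hξ.2.le.trans h1⟩).1]
    simp
  have p5 := intervalIntegral.integral_add_adjacent_intervals (hfi A (A + ε)) (hfi (A + ε) B)
  rw [htot, hsplit, p1, p2, p3, hψv] at key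
  rw [mul_ite, mul_one, mul_zero] at key
  rw [← key, ← p5, p4]
  ring

/-! ## Structure of the Riemann fan -/

namespace RiemannFan

variable (R : RiemannFan)

lemma eval_eventually (ξ : ℝ) : ∀ᶠ x in nhdsWithin ξ (Set.Ici ξ), R.eval x = R.eval ξ := by
  have h : ∀ᶠ x in nhdsWithin ξ (Set.Ici ξ), ∀ i, (R.speed i ≤ x ↔ R.speed i ≤ ξ) := by
    refine Filter.eventually_all.2 fun i => ?_
    rcases le_or_gt (R.speed i) ξ with hi | hi
    · filter_upwards [self_mem_nhdsWithin] with x hx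
      exact iff_of_true (hi.trans hx) hi
    · filter_upwards [mem_nhdsWithin_of_mem_nhds (Iio_mem_nhds hi)] with x hx
      exact iff_of_false (not_le.2 hx) (not_le.2 hi)
  filter_upwards [h] with x hx
  simp only [eval, hx]

lemma evalLeft_eventually (ξ : ℝ) : ∀ᶠ x in nhdsWithin ξ (Set.Iio ξ), R.eval x = R.evalLeft ξ := by
  have h : ∀ᶠ x in nhdsWithin ξ (Set.Iio ξ), ∀ i, (R.speed i ≤ x ↔ R.speed i < ξ) := by
    refine Filter.eventually_all.2 fun i => ?_
    rcases lt_or_ge (R.speed i) ξ with hi | hi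
    · filter_upwards [mem_nhdsWithin_of_mem_nhds (Ioi_mem_nhds hi)] with x hx
      exact iff_of_true (le_of_lt hx) hi
    · filter_upwards [self_mem_nhdsWithin] with x hx
      exact iff_of_false (not_le.2 (lt_of_lt_of_le hx hi)) (not_lt.2 hi)
  filter_upwards [h] with x hx
  simp only [eval, evalLeft, hx]

/-- No regularity of `F` is needed: the profile factors through a monotone index with values in `Fin
7`. -/
lemma measurable_comp_eval (F : RelaxVec → ℝ) : Measurable fun ξ => F (R.eval ξ) := by
  classical
  let i : ℝ → Fin 7 := fun ξ => ⟨(Finset.univ.filter fun i => R.speed i ≤ ξ).card,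
    Nat.lt_succ_of_le ((Finset.card_le_univ _).trans (by simp))⟩
  have hi : Monotone i := by
    intro x y hxy
    refine Fin.mk_le_mk.2 (Finset.card_le_card fun j hj => ?_)
    simp only [Finset.mem_filter, Finset.mem_univ, true_and] at hj ⊢
    exact hj.trans hxy
  have : (fun ξ => F (R.eval ξ)) = (fun k => F (R.state k)) ∘ i := by
    funext ξ
    simp only [eval, i, Function.comp]
  rw [this]
  exact (measurable_of_finite _).comp hi.measurable

lemma bounded_comp_eval (F : RelaxVec → ℝ) : ∃ C, ∀ ξ, |F (R.eval ξ)| ≤ C :=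
  ⟨∑ k, |F (R.state k)|, fun _ => Finset.single_le_sum (f := fun k => |F (R.state k)|)
    (fun _ _ => abs_nonneg _) (Finset.mem_univ _)⟩

lemma intervalIntegrable_comp_eval (F : RelaxVec → ℝ) (A B : ℝ) :
    IntervalIntegrable (fun ξ => F (R.eval ξ)) volume A B := by
  obtain ⟨C, hC⟩ := R.bounded_comp_eval F
  exact (intervalIntegrable_const (c := C)).mono_fun
    (R.measurable_comp_eval F).aestronglyMeasurable
    (Filter.Eventually.of_forall fun x => by simpa using (hC x).trans (le_abs_self C))

lemma rankineHugoniot_integrated {F G : RelaxVec → ℝ} {c v : ℝ}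
    (h : WeakBalance (fun ξ => F (R.eval ξ)) (fun ξ => G (R.eval ξ)) c v) {A B : ℝ} (hAB : A < B) :
    G (R.eval B) - B * F (R.eval B) - (G (R.eval A) - A * F (R.eval A)) =
      -(∫ ξ in A..B, F (R.eval ξ)) + if A < v ∧ v ≤ B then c else 0 :=
  h.integrated (R.measurable_comp_eval F) (R.bounded_comp_eval F) (R.measurable_comp_eval G)
    (R.bounded_comp_eval G)
    (fun A => (R.eval_eventually A).mono fun x hx => ⟨by simp only [hx], by simp only [hx]⟩) hAB

/-- The integrated balance is used on `(A, ξ]` with `A` so close to `ξ` that the profile equals its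
left trace on `[A, ξ)` and the Dirac mass counts only if it sits at `ξ`. -/
lemma rankineHugoniot {F G : RelaxVec → ℝ} {c v : ℝ}
    (h : WeakBalance (fun ξ => F (R.eval ξ)) (fun ξ => G (R.eval ξ)) c v) (ξ : ℝ) :
    G (R.eval ξ) - ξ * F (R.eval ξ) - (G (R.evalLeft ξ) - ξ * F (R.evalLeft ξ)) =
      if v = ξ then c else 0 := by
  obtain ⟨l, hl : l < ξ, hsub⟩ := (mem_nhdsLT_iff_exists_Ioo_subset).1 (R.evalLeft_eventually ξ)
  obtain ⟨A, hA, hA', hv⟩ : ∃ A, l < A ∧ A < ξ ∧ (v < ξ → v ≤ A) := by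
    rcases lt_or_ge v ξ with hv | hv
    · obtain ⟨A, h1, h2⟩ := exists_between (max_lt hl hv)
      exact ⟨A, (le_max_left _ _).trans_lt h1, h2, fun _ => ((le_max_right _ _).trans_lt h1).le⟩
    · obtain ⟨A, h1, h2⟩ := exists_between hl
      exact ⟨A, h1, h2, fun h' => absurd h' (not_lt.2 hv)⟩
  have h1 := R.rankineHugoniot_integrated h hA'
  have h2 : ∫ x in A..ξ, F (R.eval x) = (ξ - A) * F (R.evalLeft ξ) := by
    rw [intervalIntegral.integral_congr_Ioo_of_le (g := fun _ => F (R.evalLeft ξ)) hA'.le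
      fun x hx => congrArg F (hsub ⟨hA.trans hx.1, hx.2⟩)]
    simp
  have h3 : (A < v ∧ v ≤ ξ) ↔ v = ξ := by
    constructor
    · rintro ⟨h4, h5⟩
      exact h5.eq_of_not_lt fun h6 => absurd h4 (not_lt.2 (hv h6))
    · rintro rfl; exact ⟨hA', le_rfl⟩
  have h4 : R.eval A = R.evalLeft ξ := hsub ⟨hA, hA'⟩
  simp only [h2, h3, h4] at h1
  linarith

/-- A piecewise constant right continuous profile has zero right derivative everywhere; matching
traces make it continuous, and a continuous function with zero right derivative is constant. -/
lemma const_of_no_jump (F : RelaxVec → ℝ) {A B : ℝ} (hAB : A ≤ B)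
    (h : ∀ ξ, A < ξ → ξ ≤ B → F (R.evalLeft ξ) = F (R.eval ξ)) :
    F (R.eval B) = F (R.eval A) := by
  have hright : ∀ ξ, HasDerivWithinAt (fun x => F (R.eval x)) 0 (Set.Ici ξ) ξ := fun ξ =>
    (hasDerivWithinAt_const ξ _ (F (R.eval ξ))).congr_of_eventuallyEq
      ((R.eval_eventually ξ).mono fun x hx => by simp only [hx]) rfl
  refine constant_of_has_deriv_right_zero (f := fun x => F (R.eval x)) (fun ξ hξ => ?_)
    (fun ξ _ => hright ξ) B (Set.right_mem_Icc.2 hAB)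
  have hr := (hright ξ).continuousWithinAt
  rcases hξ.1.eq_or_lt with rfl | hlt
  · exact hr.mono Set.Icc_subset_Ici_self
  · have hl : ContinuousWithinAt (fun x => F (R.eval x)) (Set.Iio ξ) ξ := by
      refine (continuousWithinAt_const (b := F (R.evalLeft ξ))).congr_of_eventuallyEq
        ((R.evalLeft_eventually ξ).mono fun x hx => by simp only [hx]) (h ξ hlt hξ.2).symm
    have := hl.union hr
    rw [Set.Iio_union_Ici] at this
    exact this.mono (Set.subset_univ _)

end RiemannFan

namespace IsSubsonicSolution

variable {eos : Fin 2 → PhaseEOS} {a : Fin 2 → ℝ} {WL WR : RelaxVec} {R : RiemannFan}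

lemma exists_left (h : IsSubsonicSolution eos a WL WR R) (ξ : ℝ) :
    ∃ A < ξ, R.eval A = WL := by
  refine ⟨min ξ (min (WL.u 0 - a 0 * WL.τ 0) (WL.u 1 - a 1 * WL.τ 1)) - 1, ?_, ?_⟩
  · linarith [min_le_left ξ (min (WL.u 0 - a 0 * WL.τ 0) (WL.u 1 - a 1 * WL.τ 1))]
  · refine h.left_state _ fun k => ?_
    have h1 := min_le_right ξ (min (WL.u 0 - a 0 * WL.τ 0) (WL.u 1 - a 1 * WL.τ 1))
    have h2 := le_min_iff.1 h1
    fin_cases k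
    · simpa using lt_of_lt_of_le (sub_one_lt _) h2.1
    · simpa using lt_of_lt_of_le (sub_one_lt _) h2.2

lemma exists_right (h : IsSubsonicSolution eos a WL WR R) (ξ : ℝ) :
    ∃ B > ξ, R.eval B = WR := by
  refine ⟨max ξ (max (WR.u 0 + a 0 * WR.τ 0) (WR.u 1 + a 1 * WR.τ 1)) + 1, ?_, ?_⟩
  · linarith [le_max_left ξ (max (WR.u 0 + a 0 * WR.τ 0) (WR.u 1 + a 1 * WR.τ 1))]
  · refine h.right_state _ fun k => ?_
    have h1 := le_max_right ξ (max (WR.u 0 + a 0 * WR.τ 0) (WR.u 1 + a 1 * WR.τ 1))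
    have h2 := max_le_iff.1 h1
    fin_cases k
    · simpa using lt_of_le_of_lt h2.1 (lt_add_one _)
    · simpa using lt_of_le_of_lt h2.2 (lt_add_one _)

/-- The jump relation reads `(u₂* - ξ) [α] = 0`. -/
lemma alpha_jump (h : IsSubsonicSolution eos a WL WR R) (k : Fin 2) {ξ : ℝ} (hξ : ξ ≠ R.u2star) :
    (R.evalLeft ξ).α k = (R.eval ξ).α k := by
  have := R.rankineHugoniot (F := fun W => W.α k) (G := fun W => R.u2star * W.α k) (h.vol_eq k) ξ
  simp only [ite_self] at this
  exact mul_left_cancel₀ (sub_ne_zero.2 hξ) (by linarith)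

lemma alpha_eval (h : IsSubsonicSolution eos a WL WR R) (k : Fin 2) (ξ : ℝ) :
    (R.eval ξ).α k = if R.u2star ≤ ξ then WR.α k else WL.α k := by
  split_ifs with hv
  · obtain ⟨B, hB, hB'⟩ := h.exists_right ξ
    rw [← R.const_of_no_jump (fun W => W.α k) (le_of_lt hB)
      fun x hx _ => h.alpha_jump k (hv.trans_lt hx).ne', hB']
  · obtain ⟨A, hA, hA'⟩ := h.exists_left ξ
    rw [R.const_of_no_jump (fun W => W.α k) hA.le
      fun x _ hx => h.alpha_jump k (hx.trans_lt (not_le.1 hv)).ne, hA']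

lemma massFlux_continuous (h : IsSubsonicSolution eos a WL WR R) (k : Fin 2) (ξ : ℝ) :
    (R.evalLeft ξ).mass k * ((R.evalLeft ξ).u k - ξ) = (R.eval ξ).mass k * ((R.eval ξ).u k - ξ) := by
  have := R.rankineHugoniot (F := fun W => W.mass k) (G := fun W => W.mass k * W.u k) (h.mass_eq k) ξ
  simp only [ite_self] at this
  linarith

/-- Mass balance between two speeds: the relative mass flux drops by the integral of the mass, which
is positive. Hence it changes sign at most once, at the trajectory of the phase, and the fan splits
there into a left and a right part. -/
lemma massFlux_strictAnti (h : IsSubsonicSolution eos a WL WR R) (k : Fin 2) :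
    StrictAnti fun ξ => (R.eval ξ).mass k * ((R.eval ξ).u k - ξ) := by
  intro A B hAB
  have h1 := R.rankineHugoniot_integrated (F := fun W => W.mass k) (G := fun W => W.mass k * W.u k)
    (h.mass_eq k) hAB
  have h2 := intervalIntegral.intervalIntegral_pos_of_pos
    (R.intervalIntegrable_comp_eval (fun W => W.mass k) A B)
    (fun x => ((h.mem_Omega x).2.2 k).1) hAB
  simp only [ite_self] at h1 ⊢
  linarith

/-- The entropy of a phase is constant on each side of the trajectory of the phase. -/
lemma s_eval (h : IsSubsonicSolution eos a WL WR R) (k : Fin 2) (ξ : ℝ) :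
    (R.eval ξ).s k = WL.s k ∨ (R.eval ξ).s k = WR.s k := by
  -- Entropy balance minus `s` times mass balance: the relative mass flux times the jump of `s`
  -- vanishes.
  have jump : ∀ x, (R.eval x).mass k * ((R.eval x).u k - x) ≠ 0 →
      (R.evalLeft x).s k = (R.eval x).s k := by
    intro x hx
    have h1 := R.rankineHugoniot (F := fun W => W.mass k * W.s k)
      (G := fun W => W.entFlux k) (h.ent_eq k) x
    have h2 := h.massFlux_continuous k x
    simp only [ite_self, RelaxVec.entFlux] at h1
    refine mul_left_cancel₀ hx ?_
    linear_combination (-1) * h1 - (R.evalLeft x).s k * h2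
  have hanti := h.massFlux_strictAnti k
  -- Where the relative mass flux is positive it is so at every smaller speed, and `s` is carried
  -- unchanged from `WL`; where it is nonpositive, it is negative at every larger speed, and `s`
  -- agrees with `WR`.
  rcases lt_or_ge 0 ((R.eval ξ).mass k * ((R.eval ξ).u k - ξ)) with hM | hM
  · left
    obtain ⟨A, hA, hA'⟩ := h.exists_left ξ
    rw [R.const_of_no_jump (fun W => W.s k) hA.le fun x _ hx =>
      jump x (hM.trans_le (hanti.antitone hx)).ne', hA']
  · right
    obtain ⟨B, hB, hB'⟩ := h.exists_right ξ
    rw [← R.const_of_no_jump (fun W => W.s k) (le_of_lt hB) fun x hx _ =>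
      jump x ((hanti hx).trans_le hM).ne, hB']

end IsSubsonicSolution

/-! ## Thermodynamics -/

namespace PhaseEOS

variable (q : PhaseEOS)

/-- Tangent inequality of the strictly convex entropy in the variables `(τ, e)`. -/
lemma s_tangent_lt {τ e τ₀ e₀ : ℝ} (hτ : 0 < τ) (he : q.pInf * τ < e) (hτ₀ : 0 < τ₀)
    (he₀ : q.pInf * τ₀ < e₀) (hne : (τ, e) ≠ (τ₀, e₀)) :
    q.s τ₀⁻¹ e₀ - 1 / q.temp τ₀⁻¹ e₀ * (q.p τ₀⁻¹ e₀ * (τ - τ₀) + (e - e₀)) < q.s τ⁻¹ e := by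
  let D : Set (ℝ × ℝ) := {x : ℝ × ℝ | 0 < x.1 ∧ q.pInf * x.1 < x.2}
  -- The entropy is restricted to the segment from `(τ₀, e₀)` to `(τ, e)`; its slope at 0 comes from
  -- the second law, which in these variables reads `ds = -(p dτ + de) / T`.
  let ℓ : ℝ → ℝ × ℝ := fun t => AffineMap.lineMap (τ₀, e₀) (τ, e) t
  have hℓ1 : ∀ t, (ℓ t).1 = τ₀ + t * (τ - τ₀) := fun t => by
    simp [ℓ, AffineMap.lineMap_apply]; ring
  have hℓ2 : ∀ t, (ℓ t).2 = e₀ + t * (e - e₀) := fun t => by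
    simp [ℓ, AffineMap.lineMap_apply]; ring
  have hconv : StrictConvexOn ℝ (Set.Icc 0 1) fun t => q.s (ℓ t).1⁻¹ (ℓ t).2 := by
    refine ⟨convex_Icc 0 1, fun t ht r hr htr α β hα hβ hαβ => ?_⟩
    have hD : ∀ t ∈ Set.Icc (0 : ℝ) 1, ℓ t ∈ D := fun t ht =>
      q.s_strictConvex.1.lineMap_mem ⟨hτ₀, he₀⟩ ⟨hτ, he⟩ ht
    have hinj : ℓ t ≠ ℓ r := fun h' => htr (AffineMap.lineMap_injective ℝ hne.symm h')
    have := q.s_strictConvex.2 (hD t ht) (hD r hr) hinj hα hβ hαβ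
    have hcomb : ℓ (α • t + β • r) = α • ℓ t + β • ℓ r := by
      have hβ' : α = 1 - β := by linarith
      ext
      · simp only [hℓ1, Prod.fst_add, Prod.smul_fst, smul_eq_mul]; rw [hβ']; ring
      · simp only [hℓ2, Prod.snd_add, Prod.smul_snd, smul_eq_mul]; rw [hβ']; ring
    rw [← hcomb] at this
    exact this
  have hder : HasDerivAt (fun t => q.s (ℓ t).1⁻¹ (ℓ t).2)
      (-(1 / q.temp τ₀⁻¹ e₀ * (q.p τ₀⁻¹ e₀ * (τ - τ₀) + (e - e₀)))) 0 := by
    have h2 := q.second_law τ₀⁻¹ e₀ (inv_pos.2 hτ₀) (by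
      rw [inv_mul_eq_div, lt_div_iff₀ hτ₀]; exact he₀)
    have h1 : HasDerivAt (fun t => ((ℓ t).1⁻¹, (ℓ t).2)) (-(τ - τ₀) / τ₀ ^ 2, e - e₀) 0 := by
      simp only [hℓ1, hℓ2]
      refine HasDerivAt.prodMk ?_ ?_
      · have := ((((hasDerivAt_id' (0 : ℝ)).mul_const (τ - τ₀)).const_add τ₀).fun_inv
          (by simpa using hτ₀.ne'))
        simpa using this
      · simpa using (((hasDerivAt_id' (0 : ℝ)).mul_const (e - e₀)).const_add e₀)
    have h0 : ((ℓ 0).1⁻¹, (ℓ 0).2) = (τ₀⁻¹, e₀) := by simp [hℓ1, hℓ2]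
    rw [← h0] at h2
    have h3 := h2.comp_hasDerivAt (0 : ℝ) h1
    refine h3.congr_deriv ?_
    simp only [smul_apply, sub_apply,
      ContinuousLinearMap.coe_fst', ContinuousLinearMap.coe_snd', smul_eq_mul]
    field_simp
    ring
  have := StrictConvexOn.lt_slope_of_hasDerivAt hconv (Set.left_mem_Icc.2 zero_le_one)
    (Set.right_mem_Icc.2 zero_le_one) one_pos hder
  rw [slope_def_field] at this
  simp only [hℓ1, hℓ2] at this
  simp at this
  simp
  linarith

lemma s_tangent_le {τ e τ₀ e₀ : ℝ} (hτ : 0 < τ) (he : q.pInf * τ < e) (hτ₀ : 0 < τ₀)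
    (he₀ : q.pInf * τ₀ < e₀) :
    q.s τ₀⁻¹ e₀ - 1 / q.temp τ₀⁻¹ e₀ * (q.p τ₀⁻¹ e₀ * (τ - τ₀) + (e - e₀)) ≤ q.s τ⁻¹ e := by
  by_cases h : (τ, e) = (τ₀, e₀)
  · obtain ⟨rfl, rfl⟩ := Prod.mk.inj h; simp
  · exact (q.s_tangent_lt hτ he hτ₀ he₀ h).le

lemma temp_inv_pos {τ e : ℝ} (hτ : 0 < τ) (he : q.pInf * τ < e) : 0 < 1 / q.temp τ⁻¹ e :=
  one_div_pos.2 (q.temp_pos _ _ (inv_pos.2 hτ) (by rwa [inv_mul_eq_div, lt_div_iff₀ hτ]))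

lemma s_strictAnti {τ e e' : ℝ} (hτ : 0 < τ) (he : q.pInf * τ < e) (hee : e < e') :
    q.s τ⁻¹ e' < q.s τ⁻¹ e := by
  have h := q.s_tangent_lt hτ he hτ (he.trans hee) (by simp [hee.ne])
  have h1 := mul_pos (q.temp_inv_pos hτ (he.trans hee)) (sub_pos.2 hee)
  linarith

/-- `s` is a value of the entropy of the phase. -/
def IsEntropyValue (s : ℝ) : Prop := ∃ ρ e, 0 < ρ ∧ q.pInf < ρ * e ∧ q.s ρ e = s

variable {q}

/-- By `s_range` an entropy value is attained at every `τ > 0`, so the default branch of `energy` is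
never reached. -/
lemma IsEntropyValue.energy_spec {s τ : ℝ} (h : q.IsEntropyValue s) (hτ : 0 < τ) :
    q.pInf * τ < q.energy τ s ∧ q.s τ⁻¹ (q.energy τ s) = s := by
  obtain ⟨ρ, e, hρ, he, hs⟩ := h
  obtain ⟨e', he', hs'⟩ := q.s_range ρ e τ⁻¹ hρ he (inv_pos.2 hτ)
  have hex : ∃ e, q.pInf < τ⁻¹ * e ∧ q.s τ⁻¹ e = s := ⟨e', he', hs'.trans hs⟩
  have := hex.choose_spec
  rw [energy, dif_pos hex]
  exact ⟨by rw [← lt_div_iff₀ hτ, ← inv_mul_eq_div]; exact this.1, this.2⟩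

variable (q) in
lemma energy_s {τ e : ℝ} (hτ : 0 < τ) (he : q.pInf * τ < e) : q.energy τ (q.s τ⁻¹ e) = e := by
  have h : q.IsEntropyValue (q.s τ⁻¹ e) :=
    ⟨τ⁻¹, e, inv_pos.2 hτ, by rwa [inv_mul_eq_div, lt_div_iff₀ hτ], rfl⟩
  obtain ⟨h1, h2⟩ := h.energy_spec hτ
  rcases lt_trichotomy (q.energy τ (q.s τ⁻¹ e)) e with h3 | h3 | h3
  · exact absurd h2 (q.s_strictAnti hτ h1 h3).ne'
  · exact h3
  · exact absurd h2 (q.s_strictAnti hτ he h3).ne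

/-- Both states have entropy `s`, so the tangent inequality of the entropy leaves only the sign of
its linear part. Thus `-𝒫(τ₀, s)` is a subgradient of `e(·, s)`. -/
lemma IsEntropyValue.energy_tangent {s τ τ₀ : ℝ} (h : q.IsEntropyValue s) (hτ : 0 < τ)
    (hτ₀ : 0 < τ₀) : q.energy τ₀ s - q.pressure τ₀ s * (τ - τ₀) ≤ q.energy τ s := by
  obtain ⟨h1, h2⟩ := h.energy_spec hτ
  obtain ⟨h3, h4⟩ := h.energy_spec hτ₀
  have h5 := q.s_tangent_le hτ h1 hτ₀ h3
  rw [h2, h4] at h5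
  have h6 := q.temp_inv_pos hτ₀ h3
  have h7 : 0 ≤ q.pressure τ₀ s * (τ - τ₀) + (q.energy τ s - q.energy τ₀ s) := by
    refine nonneg_of_mul_nonneg_right (a := 1 / q.temp τ₀⁻¹ (q.energy τ₀ s)) ?_ h6
    simp only [pressure]; linarith
  linarith

lemma IsEntropyValue.energy_continuousOn {s : ℝ} (h : q.IsEntropyValue s) :
    ContinuousOn (fun τ => q.energy τ s) (Set.Ioi 0) := by
  refine ConvexOn.continuousOn isOpen_Ioi ⟨convex_Ioi 0, ?_⟩
  intro x hx y hy α β hα hβ hαβ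
  have hz : 0 < α • x + β • y := (convex_Ioi 0) hx hy hα hβ hαβ
  have h1 := mul_le_mul_of_nonneg_left (h.energy_tangent hx hz) hα
  have h2 := mul_le_mul_of_nonneg_left (h.energy_tangent hy hz) hβ
  simp only [smul_eq_mul] at *
  set z := α * x + β * y with hzd
  set P := q.pressure z s
  set E := q.energy z s
  have : E = α * (E - P * (x - z)) + β * (E - P * (y - z)) := by
    linear_combination (-E - P * z) * hαβ - P * hzd
  linarith

lemma isOpen_domain : IsOpen {x : ℝ × ℝ | 0 < x.1 ∧ q.pInf < x.1 * x.2} :=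
  (isOpen_lt continuous_const continuous_fst).inter
    (isOpen_lt continuous_const (continuous_fst.mul continuous_snd))

lemma IsEntropyValue.mem_domain {s τ : ℝ} (h : q.IsEntropyValue s) (hτ : 0 < τ) :
    (τ⁻¹, q.energy τ s) ∈ {x : ℝ × ℝ | 0 < x.1 ∧ q.pInf < x.1 * x.2} :=
  ⟨inv_pos.2 hτ, by
    have := (h.energy_spec hτ).1
    simpa only [inv_mul_eq_div, lt_div_iff₀ hτ] using this⟩

lemma IsEntropyValue.pressure_continuousOn {s : ℝ} (h : q.IsEntropyValue s) :
    ContinuousOn (fun τ => q.pressure τ s) (Set.Ioi 0) :=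
  q.p_contDiffOn.continuousOn.comp (f := fun τ => (τ⁻¹, q.energy τ s))
    ((continuousOn_inv₀.mono fun _ hτ => ne_of_gt hτ).prodMk h.energy_continuousOn)
    fun _ hτ => h.mem_domain hτ

/-- The subgradients at `τ` and at `t` enclose the slope between `-𝒫(τ, s)` and `-𝒫(t, s)`, and `𝒫`
is already known to be continuous in `τ`. -/
lemma IsEntropyValue.hasDerivAt_energy {s τ : ℝ} (h : q.IsEntropyValue s) (hτ : 0 < τ) :
    HasDerivAt (fun t => q.energy t s) (-q.pressure τ s) τ := by
  have hP : Filter.Tendsto (fun t => -q.pressure t s) (nhdsWithin τ {τ}ᶜ)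
      (nhds (-q.pressure τ s)) :=
    ((h.pressure_continuousOn.continuousAt (Ioi_mem_nhds hτ)).neg.tendsto).mono_left
      nhdsWithin_le_nhds
  rw [hasDerivAt_iff_tendsto_slope]
  have hpos : ∀ᶠ t in nhdsWithin τ {τ}ᶜ, 0 < t :=
    nhdsWithin_le_nhds (Ioi_mem_nhds hτ)
  have hmin : Filter.Tendsto (fun t => min (-q.pressure τ s) (-q.pressure t s))
      (nhdsWithin τ {τ}ᶜ) (nhds (-q.pressure τ s)) := by
    simpa using (tendsto_const_nhds (x := -q.pressure τ s)).min hP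
  have hmax : Filter.Tendsto (fun t => max (-q.pressure τ s) (-q.pressure t s))
      (nhdsWithin τ {τ}ᶜ) (nhds (-q.pressure τ s)) := by
    simpa using (tendsto_const_nhds (x := -q.pressure τ s)).max hP
  have hslope : ∀ᶠ t in nhdsWithin τ {τ}ᶜ,
      min (-q.pressure τ s) (-q.pressure t s) ≤ slope (fun t => q.energy t s) τ t ∧
      slope (fun t => q.energy t s) τ t ≤ max (-q.pressure τ s) (-q.pressure t s) := by
    filter_upwards [hpos, self_mem_nhdsWithin] with t ht hne
    have h1 := h.energy_tangent ht hτ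
    have h2 := h.energy_tangent hτ ht
    rw [slope_def_field]
    rcases lt_or_gt_of_ne (show t ≠ τ from hne) with hlt | hlt
    · constructor
      · refine (min_le_right _ _).trans ?_
        rw [le_div_iff_of_neg (sub_neg.2 hlt)]; linarith
      · refine le_trans ?_ (le_max_left _ _)
        rw [div_le_iff_of_neg (sub_neg.2 hlt)]; linarith
    · constructor
      · refine (min_le_left _ _).trans ?_
        rw [le_div_iff₀ (sub_pos.2 hlt)]; linarith
      · refine le_trans ?_ (le_max_right _ _)
        rw [div_le_iff₀ (sub_pos.2 hlt)]; linarith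
  exact tendsto_of_tendsto_of_tendsto_of_le_of_le' hmin hmax (hslope.mono fun _ h => h.1)
    (hslope.mono fun _ h => h.2)

lemma IsEntropyValue.differentiableAt_pressure {s τ : ℝ} (h : q.IsEntropyValue s) (hτ : 0 < τ) :
    DifferentiableAt ℝ (fun t => q.pressure t s) τ := by
  have h1 : DifferentiableAt ℝ (fun x : ℝ × ℝ => q.p x.1 x.2) (τ⁻¹, q.energy τ s) :=
    (q.p_contDiffOn.contDiffAt (isOpen_domain.mem_nhds (h.mem_domain hτ))).differentiableAt
      (by simp)
  exact h1.comp τ (f := fun t => (t⁻¹, q.energy t s))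
    ((differentiableAt_inv hτ.ne').prodMk (h.hasDerivAt_energy hτ).differentiableAt)

/-- Under Whitham's condition the relaxation energy dominates the physical energy. -/
lemma IsEntropyValue.energy_le_relaxation {s τ T a : ℝ} (h : q.IsEntropyValue s) (hτ : 0 < τ)
    (hT : 0 < T)
    (hW : ∀ t ∈ Set.uIcc τ T, -(deriv (fun x => q.pressure x s) t) < a ^ 2) :
    q.energy τ s ≤
      q.energy T s + q.pressure T s * (T - τ) + a ^ 2 * (T - τ) ^ 2 / 2 := by
  -- As a function of `t`, since `∂e/∂τ = -𝒫`, the derivative is `(∂𝒫 + a²)(t - τ)`. Whitham's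
  -- condition makes the first factor positive between `τ` and `T`, so moving from `τ` to `T`
  -- increases `φ`.
  let φ : ℝ → ℝ := fun t =>
    q.energy t s + q.pressure t s * (t - τ) + a ^ 2 * (t - τ) ^ 2 / 2
  have hφ : ∀ t, 0 < t →
      HasDerivAt φ ((deriv (fun x => q.pressure x s) t + a ^ 2) * (t - τ)) t := by
    intro t ht
    have h1 := h.hasDerivAt_energy ht
    have h2 := (h.differentiableAt_pressure ht).hasDerivAt
    have h3 := (hasDerivAt_id' t).sub_const τ
    refine ((h1.add (h2.mul h3)).add (((h3.pow 2).const_mul (a ^ 2)).div_const 2)).congr_deriv ?_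
    simp
    ring
  have hφτ : φ τ = q.energy τ s := by simp [φ]
  change _ ≤ φ T
  rw [← hφτ]
  rcases lt_trichotomy τ T with hlt | rfl | hlt
  · obtain ⟨c, hc, hc'⟩ := exists_hasDerivAt_eq_slope φ _ hlt
      (fun t ht => (hφ t (hτ.trans_le ht.1)).continuousAt.continuousWithinAt)
      (fun t ht => hφ t (hτ.trans ht.1))
    have h1 := hW c (Set.mem_uIcc.2 (Or.inl ⟨hc.1.le, hc.2.le⟩))
    have h2 := mul_pos (show 0 < deriv (fun x => q.pressure x s) c + a ^ 2 by linarith)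
      (sub_pos.2 hc.1)
    rw [hc', div_pos_iff_of_pos_right (sub_pos.2 hlt)] at h2
    linarith
  · exact le_rfl
  · obtain ⟨c, hc, hc'⟩ := exists_hasDerivAt_eq_slope φ _ hlt
      (fun t ht => (hφ t (hT.trans_le ht.1)).continuousAt.continuousWithinAt)
      (fun t ht => hφ t (hT.trans ht.1))
    have h1 := hW c (Set.mem_uIcc.2 (Or.inr ⟨hc.1.le, hc.2.le⟩))
    have h2 := mul_neg_of_pos_of_neg
      (show 0 < deriv (fun x => q.pressure x s) c + a ^ 2 by linarith) (sub_neg.2 hc.2)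
    rw [hc', div_lt_iff₀ (sub_pos.2 hlt), zero_mul] at h2
    linarith

/-- For this pressure law `c² = γ (γ - 1) (ρ e - pInf) / ρ`. -/
lemma IsStiffenedGas.soundSpeedSq_pos_iff (h : q.IsStiffenedGas) {ρ e : ℝ} (hρ : 0 < ρ)
    (he : 0 < e) : 0 < q.soundSpeedSq ρ e ↔ q.pInf < ρ * e := by
  obtain ⟨γ, hγ, hp⟩ := h
  have h1 : deriv (fun r => q.p r e) ρ = (γ - 1) * e := by
    have : (fun r => q.p r e) =ᶠ[nhds ρ] fun r => (γ - 1) * r * e - γ * q.pInf := by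
      filter_upwards [Ioi_mem_nhds hρ] with r hr using hp r e hr he
    rw [this.deriv_eq]
    simp
  have h2 : deriv (fun x => q.p ρ x) e = (γ - 1) * ρ := by
    have : (fun x => q.p ρ x) =ᶠ[nhds e] fun x => (γ - 1) * ρ * x - γ * q.pInf := by
      filter_upwards [Ioi_mem_nhds he] with x hx using hp ρ x hρ hx
    rw [this.deriv_eq]
    simp
  have h3 : q.soundSpeedSq ρ e = γ * (γ - 1) / ρ * (ρ * e - q.pInf) := by
    rw [soundSpeedSq, h1, h2, hp ρ e hρ he]
    field_simp
    ring
  have h4 : 0 < γ * (γ - 1) / ρ := div_pos (mul_pos (by linarith) (by linarith)) hρ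
  rw [h3, mul_pos_iff_of_pos_left h4, sub_pos]

end PhaseEOS

/-! ## States -/

lemma frac_pos {x : ℝ} (h0 : 0 < x) (h1 : x < 1) (k : Fin 2) : 0 < frac x k := by
  fin_cases k
  · simpa [frac] using h0
  · simpa [frac] using h1

lemma sum_frac_sub (x y : ℝ) : ∑ k, (frac x k - frac y k) = 0 := by
  simp [frac]

lemma BNVec.alpha_pos {U : BNVec} (h : U ∈ BNVec.Omega) (k : Fin 2) : 0 < U.α k :=
  frac_pos h.1 h.2.1 k

lemma BNVec.rho_pos {U : BNVec} (h : U ∈ BNVec.Omega) (k : Fin 2) : 0 < U.ρ k :=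
  div_pos (h.2.2 k).1 (U.alpha_pos h k)

lemma BNVec.e_pos {U : BNVec} (h : U ∈ BNVec.Omega) (k : Fin 2) : 0 < U.e k :=
  pos_of_mul_pos_right (h.2.2 k).2 (h.2.2 k).1.le

lemma BNVec.rho_eq (U : BNVec) (k : Fin 2) : U.ρ k = (U.α k / U.mass k)⁻¹ := by
  rw [inv_div]; rfl

lemma RelaxVec.alpha_pos {W : RelaxVec} (h : W ∈ RelaxVec.Omega) (k : Fin 2) : 0 < W.α k :=
  frac_pos h.1 h.2.1 k

lemma RelaxVec.tau_pos {W : RelaxVec} (h : W ∈ RelaxVec.Omega) (k : Fin 2) : 0 < W.τ k :=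
  div_pos (W.alpha_pos h k) (h.2.2 k).1

lemma RelaxVec.T_pos {W : RelaxVec} (h : W ∈ RelaxVec.Omega) (k : Fin 2) : 0 < W.T k :=
  div_pos (h.2.2 k).2 (h.2.2 k).1

section Equilibrium

variable (eos : Fin 2 → PhaseEOS) (a : Fin 2 → ℝ) {U : BNVec} (k : Fin 2)

lemma equilibrium_s (hU : U ∈ BNVec.Omega) : (equilibrium eos U).s k = (eos k).s (U.ρ k) (U.e k) :=
  mul_div_cancel_left₀ _ (hU.2.2 k).1.ne'

/-- At `𝒯 = τ` the relaxation term vanishes. Hence equilibrium fluxes do not depend on `a`, which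
matters because the two interfaces of a cell carry different parameters. -/
lemma equilibrium_pi (U : BNVec) : (equilibrium eos U).π k eos a =
    (eos k).pressure (U.α k / U.mass k) ((equilibrium eos U).s k) := by
  change (eos k).pressure (U.α k / U.mass k) _ + a k ^ 2 * (U.α k / U.mass k - U.α k / U.mass k) = _
  rw [sub_self, mul_zero, add_zero]

lemma equilibrium_relaxEnergy (U : BNVec) : (equilibrium eos U).relaxEnergy k eos a =
    U.u k ^ 2 / 2 + (eos k).energy (U.α k / U.mass k) ((equilibrium eos U).s k) := by
  rw [RelaxVec.relaxEnergy, equilibrium_pi]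
  change _ + (eos k).energy (U.α k / U.mass k) _ +
    (_ - (eos k).pressure (U.α k / U.mass k) _ ^ 2) / _ = _
  rw [sub_self, zero_div, add_zero]
  rfl

variable {eos k} in
lemma BNVec.admissible_iff (hU : U ∈ BNVec.Omega) :
    (eos k).pInf < U.ρ k * U.e k ↔ (eos k).pInf * (U.α k / U.mass k) < U.e k := by
  have h : 0 < U.α k / U.mass k := div_pos (U.alpha_pos hU k) (hU.2.2 k).1
  rw [U.rho_eq, inv_mul_eq_div, lt_div_iff₀ h]

lemma mass_mul_equilibrium_relaxEnergy (hU : U ∈ BNVec.Omega)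
    (hadm : (eos k).pInf < U.ρ k * U.e k) :
    U.mass k * (equilibrium eos U).relaxEnergy k eos a = U.ener k := by
  rw [equilibrium_relaxEnergy, equilibrium_s eos k hU, U.rho_eq, PhaseEOS.energy_s _
    (div_pos (U.alpha_pos hU k) (hU.2.2 k).1) ((BNVec.admissible_iff hU).1 hadm), BNVec.e,
    add_sub_cancel, mul_div_cancel₀ _ (hU.2.2 k).1.ne']

lemma isEntropyValue_equilibrium (hU : U ∈ BNVec.Omega)
    (hadm : (eos k).pInf < U.ρ k * U.e k) : (eos k).IsEntropyValue ((equilibrium eos U).s k) :=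
  ⟨U.ρ k, U.e k, U.rho_pos hU k, hadm, (equilibrium_s eos k hU).symm⟩

end Equilibrium

/-- With `d = 𝒯 - τ`, expanding `π² - 𝒫²` turns the last term of `ℰ` into `𝒫 d + a² d² / 2`. -/
lemma RelaxVec.le_relaxEnergy {W : RelaxVec} {k : Fin 2} {eos : Fin 2 → PhaseEOS} {a : Fin 2 → ℝ}
    (hW : W ∈ RelaxVec.Omega) (ha : 0 < a k) (hs : (eos k).IsEntropyValue (W.s k))
    (hwh : ∀ T ∈ Set.uIcc (W.τ k) (W.T k),
      -(deriv (fun τ => (eos k).pressure τ (W.s k)) T) < a k ^ 2) :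
    W.u k ^ 2 / 2 + (eos k).energy (W.τ k) (W.s k) ≤ W.relaxEnergy k eos a := by
  have h := hs.energy_le_relaxation (W.tau_pos hW k) (W.T_pos hW k) hwh
  have : W.relaxEnergy k eos a = W.u k ^ 2 / 2 + ((eos k).energy (W.T k) (W.s k) +
      (eos k).pressure (W.T k) (W.s k) * (W.T k - W.τ k) +
      a k ^ 2 * (W.T k - W.τ k) ^ 2 / 2) := by
    rw [RelaxVec.relaxEnergy, RelaxVec.π]
    field_simp
    ring
  linarith

/-! ## Averages over a cell -/

/-- Average over a cell, after a time step of ratio `r = Δt / Δx`, of `Fl` in the right half of the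
fan `Rl` issued from the left interface and of `Fr` in the left half of the fan `Rr` issued from the
right interface. -/
def cellMean (r : ℝ) (Rl Rr : RiemannFan) (Fl Fr : RelaxVec → ℝ) : ℝ :=
  r * ((∫ ξ in 0..(1 / (2 * r)), Fl (Rl.eval ξ)) + ∫ ξ in (-(1 / (2 * r)))..0, Fr (Rr.eval ξ))

section CellMean

variable {r : ℝ} {Rl Rr : RiemannFan}

/-- Tangent planes to the kinetic energy and to the entropy are such three-term combinations;
averaging them gives Jensen's inequality. -/
lemma cellMean_lincomb (F₁ F₂ F₃ : RelaxVec → ℝ) (b₁ b₂ b₃ : ℝ) :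
    cellMean r Rl Rr (fun W => b₁ * F₁ W + b₂ * F₂ W + b₃ * F₃ W)
        (fun W => b₁ * F₁ W + b₂ * F₂ W + b₃ * F₃ W) =
      b₁ * cellMean r Rl Rr F₁ F₁ + b₂ * cellMean r Rl Rr F₂ F₂ +
        b₃ * cellMean r Rl Rr F₃ F₃ := by
  have key : ∀ (R : RiemannFan) (A B : ℝ),
      ∫ ξ in A..B, (b₁ * F₁ (R.eval ξ) + b₂ * F₂ (R.eval ξ) + b₃ * F₃ (R.eval ξ)) =
        b₁ * (∫ ξ in A..B, F₁ (R.eval ξ)) + b₂ * (∫ ξ in A..B, F₂ (R.eval ξ)) +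
          b₃ * ∫ ξ in A..B, F₃ (R.eval ξ) := by
    intro R A B
    have h : ∀ (F : RelaxVec → ℝ) (b : ℝ),
        IntervalIntegrable (fun ξ => b * F (R.eval ξ)) volume A B := fun F b =>
      (R.intervalIntegrable_comp_eval F A B).const_mul b
    rw [intervalIntegral.integral_add ((h F₁ b₁).add (h F₂ b₂)) (h F₃ b₃),
      intervalIntegral.integral_add (h F₁ b₁) (h F₂ b₂), intervalIntegral.integral_const_mul,
      intervalIntegral.integral_const_mul, intervalIntegral.integral_const_mul]
  simp only [cellMean, key]
  ring

lemma cellMean_mono (hr : 0 < r) {Fl Fr Gl Gr : RelaxVec → ℝ}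
    (hl : ∀ ξ, Fl (Rl.eval ξ) ≤ Gl (Rl.eval ξ)) (hr' : ∀ ξ, Fr (Rr.eval ξ) ≤ Gr (Rr.eval ξ)) :
    cellMean r Rl Rr Fl Fr ≤ cellMean r Rl Rr Gl Gr := by
  have hH : 0 < 1 / (2 * r) := by positivity
  refine mul_le_mul_of_nonneg_left (add_le_add ?_ ?_) hr.le
  · exact intervalIntegral.integral_mono hH.le (Rl.intervalIntegrable_comp_eval Fl _ _)
      (Rl.intervalIntegrable_comp_eval Gl _ _) hl
  · exact intervalIntegral.integral_mono (by linarith) (Rr.intervalIntegrable_comp_eval Fr _ _)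
      (Rr.intervalIntegrable_comp_eval Gr _ _) hr'

lemma cellMean_pos (hr : 0 < r) {Fl Fr : RelaxVec → ℝ}
    (hl : ∀ ξ, 0 < Fl (Rl.eval ξ)) (hr' : ∀ ξ, 0 < Fr (Rr.eval ξ)) :
    0 < cellMean r Rl Rr Fl Fr := by
  have hH : 0 < 1 / (2 * r) := by positivity
  exact mul_pos hr (add_pos
    (intervalIntegral.intervalIntegral_pos_of_pos (Rl.intervalIntegrable_comp_eval Fl _ _) hl hH)
    (intervalIntegral.intervalIntegral_pos_of_pos (Rr.intervalIntegrable_comp_eval Fr _ _) hr'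
      (by linarith)))

/-- Godunov's formula: the cell average in terms of fluxes through the two interfaces. -/
lemma cellMean_eq (hr : 0 < r) {Fl Fr Gl Gr : RelaxVec → ℝ} {cl cr vl vr : ℝ} {W : RelaxVec}
    (hl : WeakBalance (fun ξ => Fl (Rl.eval ξ)) (fun ξ => Gl (Rl.eval ξ)) cl vl)
    (hr' : WeakBalance (fun ξ => Fr (Rr.eval ξ)) (fun ξ => Gr (Rr.eval ξ)) cr vr)
    (hvl : vl < 1 / (2 * r)) (hvr : -(1 / (2 * r)) < vr)
    (hWl : Rl.eval (1 / (2 * r)) = W) (hWr : Rr.eval (-(1 / (2 * r))) = W) (hF : Fl W = Fr W) :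
    cellMean r Rl Rr Fl Fr = Fr W
      - r * ((Gr (Rr.eval 0) - if vr ≤ 0 then cr else 0) -
        (Gl (Rl.eval 0) + if 0 < vl then cl else 0)) + r * (Gr W - Gl W) := by
  have hH : 0 < 1 / (2 * r) := by positivity
  have h1 := Rl.rankineHugoniot_integrated hl hH
  have h2 := Rr.rankineHugoniot_integrated hr' (show -(1 / (2 * r)) < 0 by linarith)
  rw [hWl] at h1
  rw [hWr] at h2
  simp only [hvl.le, and_true] at h1
  simp only [hvr, true_and] at h2
  -- Each fan contributes half a cell, so the cell value enters once from each side with weight 1/2.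
  have h3 : r * (1 / (2 * r)) = 1 / 2 := by field_simp
  rw [cellMean]
  linear_combination r * h1 + r * h2 + (Fl W + Fr W) * h3 + 1 / 2 * hF

end CellMean

/-! ## Evolution of one cell -/

lemma IsSubsonicSolution.ener_eq {eos : Fin 2 → PhaseEOS} {a : Fin 2 → ℝ} {WL WR : RelaxVec}
    {R : RiemannFan} (h : IsSubsonicSolution eos a WL WR R) (k : Fin 2) : ∃ Q : ℝ, 0 ≤ Q ∧
      WeakBalance (fun ξ => (R.eval ξ).mass k * (R.eval ξ).relaxEnergy k eos a)
        (fun ξ => (R.eval ξ).enerFlux k eos a)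
        (R.u2star * R.pi1star * (WR.α k - WL.α k) - Q) R.u2star := by
  fin_cases k
  · exact h.ener1_eq
  · refine ⟨0, le_rfl, ?_⟩
    rw [sub_zero]
    exact h.ener2_eq

/-- The waves of `R` stay in the half cells next to the interface during the time step. -/
structure HalfCell (r : ℝ) (WL WR : RelaxVec) (R : RiemannFan) : Prop where
  eval_neg : R.eval (-(1 / (2 * r))) = WL
  eval_pos : R.eval (1 / (2 * r)) = WR
  neg_lt : -(1 / (2 * r)) < R.u2star
  lt_pos : R.u2star < 1 / (2 * r)

lemma CFL.halfCell {eos : Fin 2 → PhaseEOS} {Δt Δx : ℝ} (hr : 0 < Δt / Δx) {a : ℤ → Fin 2 → ℝ}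
    {U : ℤ → BNVec} (h : CFL Δt Δx a U) {R : RiemannFan} {j : ℤ}
    (hR : IsSubsonicSolution eos (a j) (equilibrium eos (U j)) (equilibrium eos (U (j + 1))) R) :
    HalfCell (Δt / Δx) (equilibrium eos (U j)) (equilibrium eos (U (j + 1))) R := by
  have hb : ∀ k, -(1 / (2 * (Δt / Δx))) <
        (equilibrium eos (U j)).u k - a j k * (equilibrium eos (U j)).τ k ∧
      (equilibrium eos (U (j + 1))).u k + a j k * (equilibrium eos (U (j + 1))).τ k <
        1 / (2 * (Δt / Δx)) := by
    intro k
    have h1 : max |(U j).u k - a j k * ((U j).ρ k)⁻¹|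
        |(U (j + 1)).u k + a j k * ((U (j + 1)).ρ k)⁻¹| < 1 / (2 * (Δt / Δx)) := by
      rw [lt_div_iff₀ (by positivity)]
      have := h k j
      linarith
    rw [max_lt_iff, (U j).rho_eq, (U (j + 1)).rho_eq, inv_inv, inv_inv] at h1
    exact ⟨(abs_lt.1 h1.1).1, (abs_lt.1 h1.2).2⟩
  exact ⟨hR.left_state _ fun k => (hb k).1, hR.right_state _ fun k => (hb k).2,
    (hb 0).1.trans hR.subsonic_left, hR.subsonic_right.trans (hb 0).2⟩

/-- Two neighbouring Riemann solutions that do not interact within the cell `UC`. -/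
structure CellStep (eos : Fin 2 → PhaseEOS) (r : ℝ) (al ar : Fin 2 → ℝ) (Rl Rr : RiemannFan)
    (UL UC UR : BNVec) : Prop where
  r_pos : 0 < r
  al_pos : ∀ k, 0 < al k
  ar_pos : ∀ k, 0 < ar k
  left : IsSubsonicSolution eos al (equilibrium eos UL) (equilibrium eos UC) Rl
  right : IsSubsonicSolution eos ar (equilibrium eos UC) (equilibrium eos UR) Rr
  halfLeft : HalfCell r (equilibrium eos UL) (equilibrium eos UC) Rl
  halfRight : HalfCell r (equilibrium eos UC) (equilibrium eos UR) Rr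
  memL : UL ∈ BNVec.Omega
  memC : UC ∈ BNVec.Omega
  memR : UR ∈ BNVec.Omega

/-- The state of the cell `UC` after one time step. -/
def nextState (eos : Fin 2 → PhaseEOS) (r : ℝ) (al ar : Fin 2 → ℝ) (Rl Rr : RiemannFan)
    (UL UC UR : BNVec) : BNVec :=
  BNVec.update r UC (fluxMinus eos ar Rr UC UR) (fluxPlus eos al Rl UL UC)

namespace CellStep

variable {eos : Fin 2 → PhaseEOS} {r : ℝ} {al ar : Fin 2 → ℝ} {Rl Rr : RiemannFan}
  {UL UC UR : BNVec}

lemma zero_lt (h : CellStep eos r al ar Rl Rr UL UC UR) : 0 < 1 / (2 * r) := by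
  have := h.r_pos
  positivity

lemma alpha_eq (h : CellStep eos r al ar Rl Rr UL UC UR) (k : Fin 2) :
    (nextState eos r al ar Rl Rr UL UC UR).α k =
      cellMean r Rl Rr (fun W => W.α k) (fun W => W.α k) := by
  have hl := h.left.alpha_eval k 0
  have hr := h.right.alpha_eval k 0
  rw [cellMean_eq h.r_pos (Gl := fun W => Rl.u2star * W.α k) (Gr := fun W => Rr.u2star * W.α k)
    (h.left.vol_eq k) (h.right.vol_eq k) h.zero_lt (neg_lt_zero.2 h.zero_lt) h.halfLeft.eval_pos
    h.halfRight.eval_neg rfl]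
  have e1 : (nextState eos r al ar Rl Rr UL UC UR).α k = UC.α k -
      r * ((if Rr.u2star < 0 then Rr.u2star * (UR.α k - UC.α k) else 0) +
        if 0 < Rl.u2star then Rl.u2star * (UC.α k - UL.α k) else 0) := by
    simp only [nextState, BNVec.α, BNVec.update, fluxMinus, fluxPlus]
    fin_cases k
    · simp [frac]
    · simp only [frac]
      split_ifs <;> simp <;> ring
  have hL : (equilibrium eos UL).α k = UL.α k := rfl
  have hC : (equilibrium eos UC).α k = UC.α k := rfl
  have hR : (equilibrium eos UR).α k = UR.α k := rfl
  rw [e1]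
  simp only [hl, hr, hL, hC, hR, ite_self]
  rcases lt_trichotomy Rr.u2star 0 with h1 | h1 | h1 <;>
  rcases lt_trichotomy Rl.u2star 0 with h2 | h2 | h2 <;>
  simp [h1, h2, h1.le, h2.le, h1.not_gt, h2.not_gt, ← not_lt] <;> ring

lemma mass_eq (h : CellStep eos r al ar Rl Rr UL UC UR) (k : Fin 2) :
    (nextState eos r al ar Rl Rr UL UC UR).mass k =
      cellMean r Rl Rr (fun W => W.mass k) (fun W => W.mass k) := by
  rw [cellMean_eq h.r_pos (Gl := fun W => W.mass k * W.u k) (Gr := fun W => W.mass k * W.u k)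
    (h.left.mass_eq k) (h.right.mass_eq k) h.zero_lt (neg_lt_zero.2 h.zero_lt) h.halfLeft.eval_pos
    h.halfRight.eval_neg rfl]
  have h1 := h.right.massFlux_continuous k 0
  simp only [sub_zero] at h1
  simp only [ite_self, nextState, BNVec.update, fluxMinus, fluxPlus, h1, equilibrium]
  ring

lemma momFlux_equilibrium (eos : Fin 2 → PhaseEOS) (a b : Fin 2 → ℝ) (U : BNVec) (k : Fin 2) :
    (equilibrium eos U).momFlux k eos a = (equilibrium eos U).momFlux k eos b := by
  rw [RelaxVec.momFlux, RelaxVec.momFlux, equilibrium_pi, equilibrium_pi]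

lemma mom_eq (h : CellStep eos r al ar Rl Rr UL UC UR) (k : Fin 2) :
    (nextState eos r al ar Rl Rr UL UC UR).mom k =
      cellMean r Rl Rr (fun W => W.mass k * W.u k) (fun W => W.mass k * W.u k) := by
  rw [cellMean_eq h.r_pos (Gl := fun W => W.momFlux k eos al) (Gr := fun W => W.momFlux k eos ar)
    (h.left.mom_eq k) (h.right.mom_eq k) h.halfLeft.lt_pos h.halfRight.neg_lt h.halfLeft.eval_pos
    h.halfRight.eval_neg rfl, momFlux_equilibrium eos ar al]
  have h1 := Rr.rankineHugoniot (F := fun W => W.mass k * W.u k)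
    (G := fun W => W.momFlux k eos ar) (h.right.mom_eq k) 0
  have hm : (equilibrium eos UC).mass k * (equilibrium eos UC).u k = UC.mom k :=
    mul_div_cancel₀ _ (h.memC.2.2 k).1.ne'
  rw [hm]
  change UC.mom k - r * (((Rr.evalLeft 0).momFlux k eos ar -
    if Rr.u2star < 0 then Rr.pi1star * ((equilibrium eos UR).α k - (equilibrium eos UC).α k) else 0)
    - ((Rl.eval 0).momFlux k eos al +
      if 0 < Rl.u2star then Rl.pi1star * ((equilibrium eos UC).α k - (equilibrium eos UL).α k)
      else 0)) = _
  -- The scheme uses the left trace with the indicator of `u₂* < 0`, the average the right trace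
  -- with that of `u₂* ≤ 0`. For `u₂* = 0` the jump of the flux at 0 is exactly the Dirac mass.
  have h2 : (Rr.evalLeft 0).momFlux k eos ar - (if Rr.u2star < 0 then
      Rr.pi1star * ((equilibrium eos UR).α k - (equilibrium eos UC).α k) else 0) =
      (Rr.eval 0).momFlux k eos ar - if Rr.u2star ≤ 0 then
      Rr.pi1star * ((equilibrium eos UR).α k - (equilibrium eos UC).α k) else 0 := by
    rcases lt_trichotomy Rr.u2star 0 with h3 | h3 | h3
    · rw [if_neg h3.ne] at h1
      rw [if_pos h3, if_pos h3.le]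
      linarith
    · rw [if_pos h3] at h1
      rw [if_neg h3.not_lt, if_pos h3.le]
      linarith
    · rw [if_neg h3.ne'] at h1
      rw [if_neg h3.not_gt, if_neg h3.not_ge]
      linarith
  rw [h2]
  ring

lemma entFlux_eq (h : CellStep eos r al ar Rl Rr UL UC UR) (k : Fin 2) :
    UC.entropy k eos - r * ((Rr.eval 0).entFlux k - (Rl.eval 0).entFlux k) =
      cellMean r Rl Rr (fun W => W.mass k * W.s k) (fun W => W.mass k * W.s k) := by
  rw [cellMean_eq h.r_pos (Gl := fun W => W.entFlux k) (Gr := fun W => W.entFlux k)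
    (h.left.ent_eq k) (h.right.ent_eq k) h.zero_lt (neg_lt_zero.2 h.zero_lt) h.halfLeft.eval_pos
    h.halfRight.eval_neg rfl]
  have hm : (equilibrium eos UC).mass k * (equilibrium eos UC).s k = UC.entropy k eos :=
    mul_div_cancel₀ _ (h.memC.2.2 k).1.ne'
  simp only [ite_self, hm]
  ring

lemma enerFlux_equilibrium (eos : Fin 2 → PhaseEOS) (a b : Fin 2 → ℝ) (U : BNVec) (k : Fin 2) :
    (equilibrium eos U).enerFlux k eos a = (equilibrium eos U).enerFlux k eos b := by
  rw [RelaxVec.enerFlux, RelaxVec.enerFlux, equilibrium_relaxEnergy, equilibrium_relaxEnergy,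
    equilibrium_pi, equilibrium_pi]

lemma le_ener (h : CellStep eos r al ar Rl Rr UL UC UR) (k : Fin 2)
    (hadm : (eos k).pInf < UC.ρ k * UC.e k) :
    cellMean r Rl Rr (fun W => W.mass k * W.relaxEnergy k eos al)
        (fun W => W.mass k * W.relaxEnergy k eos ar) ≤
      (nextState eos r al ar Rl Rr UL UC UR).ener k := by
  obtain ⟨Ql, hQl, hl⟩ := h.left.ener_eq k
  obtain ⟨Qr, hQr, hr⟩ := h.right.ener_eq k
  have hE : ∀ a, (equilibrium eos UC).mass k * (equilibrium eos UC).relaxEnergy k eos a =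
      UC.ener k := fun a => mass_mul_equilibrium_relaxEnergy eos a k h.memC hadm
  rw [cellMean_eq h.r_pos (Gl := fun W => W.enerFlux k eos al) (Gr := fun W => W.enerFlux k eos ar)
    hl hr h.halfLeft.lt_pos h.halfRight.neg_lt h.halfLeft.eval_pos
    h.halfRight.eval_neg ((hE al).trans (hE ar).symm), enerFlux_equilibrium eos ar al, hE]
  change _ ≤ UC.ener k - r * (((Rr.eval 0).enerFlux k eos ar - if Rr.u2star ≤ 0 then
      Rr.u2star * Rr.pi1star * ((equilibrium eos UR).α k - (equilibrium eos UC).α k) else 0)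
    - ((Rl.eval 0).enerFlux k eos al + if 0 ≤ Rl.u2star then
      Rl.u2star * Rl.pi1star * ((equilibrium eos UC).α k - (equilibrium eos UL).α k) else 0))
  rw [sub_self, mul_zero, add_zero]
  -- The two sides differ only by the sinks `Q` located in this cell and by a term with the factor
  -- `u₂* = 0`.
  refine sub_le_sub_left (mul_le_mul_of_nonneg_left (sub_le_sub ?_ ?_) h.r_pos.le) _
  · split_ifs <;> linarith
  · rcases lt_trichotomy Rl.u2star 0 with h3 | h3 | h3
    · rw [if_neg h3.not_gt, if_neg h3.not_ge]
    · rw [if_neg h3.not_gt, if_pos h3.ge, h3, zero_mul, zero_mul]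
    · rw [if_pos h3, if_pos h3.le]; linarith

lemma alpha_pos (h : CellStep eos r al ar Rl Rr UL UC UR) (k : Fin 2) :
    0 < (nextState eos r al ar Rl Rr UL UC UR).α k := by
  rw [h.alpha_eq]
  exact cellMean_pos h.r_pos (fun ξ => RelaxVec.alpha_pos (h.left.mem_Omega ξ) k)
    fun ξ => RelaxVec.alpha_pos (h.right.mem_Omega ξ) k

lemma mass_pos (h : CellStep eos r al ar Rl Rr UL UC UR) (k : Fin 2) :
    0 < (nextState eos r al ar Rl Rr UL UC UR).mass k := by
  rw [h.mass_eq]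
  exact cellMean_pos h.r_pos (fun ξ => ((h.left.mem_Omega ξ).2.2 k).1)
    fun ξ => ((h.right.mem_Omega ξ).2.2 k).1

/-- Admissibility and entropy inequality of one phase after a time step. -/
lemma admissible_and_entropy (h : CellStep eos r al ar Rl Rr UL UC UR) (k : Fin 2)
    (hL : (eos k).pInf < UL.ρ k * UL.e k) (hC : (eos k).pInf < UC.ρ k * UC.e k)
    (hR : (eos k).pInf < UR.ρ k * UR.e k)
    (hwl : Whitham eos al Rl) (hwr : Whitham eos ar Rr) :
    (eos k).pInf < (nextState eos r al ar Rl Rr UL UC UR).ρ k *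
        (nextState eos r al ar Rl Rr UL UC UR).e k ∧
      (nextState eos r al ar Rl Rr UL UC UR).entropy k eos ≤
        UC.entropy k eos - r * ((Rr.eval 0).entFlux k - (Rl.eval 0).entFlux k) := by
  have hα := h.alpha_pos k
  have hm := h.mass_pos k
  have eα := h.alpha_eq k
  have em := h.mass_eq k
  have eu := h.mom_eq k
  have eE := h.le_ener k hC
  rw [h.entFlux_eq]
  set V := nextState eos r al ar Rl Rr UL UC UR
  have hvL := isEntropyValue_equilibrium eos k h.memL hL
  have hvC := isEntropyValue_equilibrium eos k h.memC hC
  have hvR := isEntropyValue_equilibrium eos k h.memR hR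
  have hsl : ∀ ξ, (eos k).IsEntropyValue ((Rl.eval ξ).s k) := fun ξ => by
    rcases h.left.s_eval k ξ with h' | h' <;> rwa [h']
  have hsr : ∀ ξ, (eos k).IsEntropyValue ((Rr.eval ξ).s k) := fun ξ => by
    rcases h.right.s_eval k ξ with h' | h' <;> rwa [h']
  let ε : RelaxVec → ℝ := fun W => (eos k).energy (W.τ k) (W.s k)
  let Eint : RelaxVec → ℝ := fun W => W.mass k * ε W
  set E := cellMean r Rl Rr Eint Eint
  -- `(τ, e)` is the mass-weighted mean of the pairs `(τ, e(τ, s))` over the two fans; `τ` is also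
  -- the new specific volume.
  set τ := V.α k / V.mass k with hτdef
  set e := E / V.mass k with hedef
  have hτ : 0 < τ := div_pos hα hm
  have hmτ : V.mass k * τ = V.α k := mul_div_cancel₀ _ hm.ne'
  have hme : V.mass k * e = E := mul_div_cancel₀ _ hm.ne'
  have hmτW : ∀ W ∈ RelaxVec.Omega, W.mass k * W.τ k = W.α k := fun W hW =>
    mul_div_cancel₀ _ (hW.2.2 k).1.ne'
  -- the mean internal energy is admissible
  have hadm : (eos k).pInf * τ < e := by
    have hpos : ∀ W ∈ RelaxVec.Omega, (eos k).IsEntropyValue (W.s k) →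
        0 < 1 * Eint W + -(eos k).pInf * W.α k + 0 * W.α k := by
      intro W hW hs
      have h1 := (hs.energy_spec (W.tau_pos hW k)).1
      have h2 := mul_pos (hW.2.2 k).1 (sub_pos.2 h1)
      have h3 := hmτW W hW
      have : 1 * Eint W + -(eos k).pInf * W.α k + 0 * W.α k =
          W.mass k * ((eos k).energy (W.τ k) (W.s k) - (eos k).pInf * W.τ k) := by
        simp only [Eint, ε, ← h3]; ring
      rwa [this]
    have := cellMean_pos h.r_pos
      (Fl := fun W => 1 * Eint W + -(eos k).pInf * W.α k + 0 * W.α k)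
      (Fr := fun W => 1 * Eint W + -(eos k).pInf * W.α k + 0 * W.α k)
      (fun ξ => hpos _ (h.left.mem_Omega ξ) (hsl ξ))
      (fun ξ => hpos _ (h.right.mem_Omega ξ) (hsr ξ))
    rw [cellMean_lincomb Eint (fun W => W.α k) (fun W => W.α k), ← eα] at this
    rw [hτdef, hedef, ← mul_div_assoc, div_lt_div_iff_of_pos_right hm]
    change 0 < 1 * E + _ + _ at this
    linarith
  -- the kinetic energy and the dissipation only increase the internal energy
  have hle : e ≤ V.e k := by
    -- The kinetic energy is bounded below by its tangent at the new velocity `V.u k`, whose average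
    -- is the kinetic energy of the new state.
    have hpt : ∀ W ∈ RelaxVec.Omega, ∀ a : Fin 2 → ℝ, 0 < a k →
        (eos k).IsEntropyValue (W.s k) → (∀ T ∈ Set.uIcc (W.τ k) (W.T k),
          -(deriv (fun τ => (eos k).pressure τ (W.s k)) T) < a k ^ 2) →
        V.u k * (W.mass k * W.u k) + -(V.u k ^ 2 / 2) * W.mass k + 1 * Eint W ≤
          W.mass k * W.relaxEnergy k eos a := by
      intro W hW a ha hs hwh
      have h1 := mul_le_mul_of_nonneg_left (RelaxVec.le_relaxEnergy hW ha hs hwh) (hW.2.2 k).1.le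
      refine le_trans ?_ h1
      have h2 := mul_nonneg (hW.2.2 k).1.le (sq_nonneg (W.u k - V.u k))
      simp only [Eint, ε]
      linarith
    let F : RelaxVec → ℝ := fun W =>
      V.u k * (W.mass k * W.u k) + -(V.u k ^ 2 / 2) * W.mass k + 1 * Eint W
    have := cellMean_mono h.r_pos (Fl := F) (Fr := F)
      (Gl := fun W => W.mass k * W.relaxEnergy k eos al)
      (Gr := fun W => W.mass k * W.relaxEnergy k eos ar)
      (fun ξ => hpt _ (h.left.mem_Omega ξ) al (h.al_pos k) (hsl ξ) (hwl k ξ))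
      (fun ξ => hpt _ (h.right.mem_Omega ξ) ar (h.ar_pos k) (hsr ξ) (hwr k ξ))
    rw [cellMean_lincomb (fun W => W.mass k * W.u k) (fun W => W.mass k) Eint, ← eu, ← em] at this
    have h3 := this.trans eE
    have h4 : V.mass k * V.u k = V.mom k := mul_div_cancel₀ _ hm.ne'
    rw [BNVec.e, hedef, le_sub_iff_add_le, le_div_iff₀ hm, add_mul, div_mul_cancel₀ _ hm.ne']
    change _ + _ + 1 * E ≤ _ at h3
    rw [← h4] at h3
    linarith
  refine ⟨?_, ?_⟩
  · rw [V.rho_eq, inv_mul_eq_div, lt_div_iff₀ hτ]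
    exact hadm.trans_le hle
  -- The tangent plane to the entropy at the mean `(τ, e)`, multiplied by the mass, has cell average
  -- `V.mass k * s(τ, e)`.
  · set θ := 1 / (eos k).temp τ⁻¹ e
    set P := (eos k).p τ⁻¹ e
    have hpt : ∀ W ∈ RelaxVec.Omega, (eos k).IsEntropyValue (W.s k) →
        ((eos k).s τ⁻¹ e + θ * (P * τ + e)) * W.mass k + -(θ * P) * W.α k + -θ * Eint W ≤
          W.mass k * W.s k := by
      intro W hW hs
      obtain ⟨h1, h2⟩ := hs.energy_spec (W.tau_pos hW k)
      have h3 := (eos k).s_tangent_le (W.tau_pos hW k) h1 hτ hadm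
      rw [h2] at h3
      have h4 := mul_le_mul_of_nonneg_left h3 (hW.2.2 k).1.le
      refine le_trans (le_of_eq ?_) h4
      simp only [Eint, ε, ← hmτW W hW]
      ring
    let F : RelaxVec → ℝ := fun W =>
      ((eos k).s τ⁻¹ e + θ * (P * τ + e)) * W.mass k + -(θ * P) * W.α k + -θ * Eint W
    have h5 := cellMean_mono h.r_pos (Fl := F) (Fr := F) (Gl := fun W => W.mass k * W.s k)
      (Gr := fun W => W.mass k * W.s k) (fun ξ => hpt _ (h.left.mem_Omega ξ) (hsl ξ))
      (fun ξ => hpt _ (h.right.mem_Omega ξ) (hsr ξ))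
    rw [cellMean_lincomb (fun W => W.mass k) (fun W => W.α k) Eint, ← em, ← eα] at h5
    change _ + _ + -θ * E ≤ _ at h5
    rw [← hmτ, ← hme] at h5
    -- Passing from the mean energy to the larger actual one lowers the entropy.
    have h6 : (eos k).s τ⁻¹ (V.e k) ≤ (eos k).s τ⁻¹ e := by
      rcases hle.eq_or_lt with h' | h'
      · rw [← h']
      · exact ((eos k).s_strictAnti hτ hadm h').le
    rw [BNVec.entropy, V.rho_eq]
    have h7 := mul_le_mul_of_nonneg_left h6 hm.le
    linarith

lemma next_mem_Omega (h : CellStep eos r al ar Rl Rr UL UC UR)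
    (hadm : ∀ k, (eos k).pInf < (nextState eos r al ar Rl Rr UL UC UR).ρ k *
        (nextState eos r al ar Rl Rr UL UC UR).e k) :
    nextState eos r al ar Rl Rr UL UC UR ∈ BNVec.Omega := by
  have h0 : 0 < (nextState eos r al ar Rl Rr UL UC UR).vol := by
    simpa [BNVec.α, frac] using h.alpha_pos 0
  have h1 : (nextState eos r al ar Rl Rr UL UC UR).vol < 1 := by
    simpa [BNVec.α, frac] using h.alpha_pos 1
  refine ⟨h0, h1, fun k => ⟨h.mass_pos k, mul_pos (h.mass_pos k) ?_⟩⟩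
  exact pos_of_mul_pos_right ((eos k).pInf_nonneg.trans_lt (hadm k))
    (div_pos (h.mass_pos k) (h.alpha_pos k)).le

end CellStep

/-! ## Conservativity and the sound speed -/

lemma isConservativeUpdate_of_scheme {r : ℝ} {q q' Fm Fp : ℤ → ℝ} (h : ∀ j, Fm j = Fp j)
    (hq : ∀ j, q' j = q j - r * (Fm j - Fp (j - 1))) : IsConservativeUpdate r q q' Fm Fp :=
  ⟨h, fun j => by rw [hq, h (j - 1)]⟩

section Conservativity

variable {eos : Fin 2 → PhaseEOS} {a : Fin 2 → ℝ} {UL UR : BNVec} {R : RiemannFan}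

lemma sum_mul_alpha_sub (b : ℝ) (UL UR : BNVec) : ∑ k, b * (UR.α k - UL.α k) = 0 := by
  rw [← Finset.mul_sum]
  simp only [BNVec.α, sum_frac_sub, mul_zero]

lemma sum_ite_mul_alpha_sub (P : Prop) [Decidable P] (b : ℝ) (UL UR : BNVec) :
    ∑ k, (if P then b * (UR.α k - UL.α k) else 0) = 0 := by
  split_ifs
  · exact sum_mul_alpha_sub b UL UR
  · exact Finset.sum_const_zero

lemma fluxMinus_mass_eq (h : IsSubsonicSolution eos a (equilibrium eos UL) (equilibrium eos UR) R)
    (k : Fin 2) : (fluxMinus eos a R UL UR).mass k = (fluxPlus eos a R UL UR).mass k := by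
  have := h.massFlux_continuous k 0
  simp only [sub_zero] at this
  exact this

/-- The momentum flux of each phase jumps at 0 only if `u₂* = 0`, by a multiple of `Δα_k` with the
same factor for both phases; since `Δα₁ + Δα₂ = 0`, the sum has no jump. -/
lemma sum_fluxMinus_mom_eq
    (h : IsSubsonicSolution eos a (equilibrium eos UL) (equilibrium eos UR) R) :
    ∑ k, (fluxMinus eos a R UL UR).mom k = ∑ k, (fluxPlus eos a R UL UR).mom k := by
  have hk : ∀ k, (R.eval 0).momFlux k eos a = (R.evalLeft 0).momFlux k eos a +
      if R.u2star = 0 then R.pi1star * (UR.α k - UL.α k) else 0 := fun k => by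
    have := R.rankineHugoniot (F := fun W => W.mass k * W.u k)
      (G := fun W => W.momFlux k eos a) (h.mom_eq k) 0
    simp only [zero_mul, sub_zero] at this
    exact sub_eq_iff_eq_add'.1 this
  simp only [fluxMinus, fluxPlus, Finset.sum_sub_distrib, Finset.sum_add_distrib,
    sum_ite_mul_alpha_sub, hk, sub_zero, add_zero]

/-- Both energy fluxes use the trace at `0⁺`, so only the terms in `Δα_k` differ, and these sum to
zero. -/
lemma sum_fluxMinus_ener_eq (eos : Fin 2 → PhaseEOS) (a : Fin 2 → ℝ) (R : RiemannFan)
    (UL UR : BNVec) :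
    ∑ k, (fluxMinus eos a R UL UR).ener k = ∑ k, (fluxPlus eos a R UL UR).ener k := by
  simp only [fluxMinus, fluxPlus, Finset.sum_sub_distrib, Finset.sum_add_distrib,
    sum_ite_mul_alpha_sub, sub_zero, add_zero]

end Conservativity

lemma soundSpeedSq_pos_iff {eos : Fin 2 → PhaseEOS} {k : Fin 2} (h : (eos k).IsStiffenedGas)
    {U : BNVec} (hU : U ∈ BNVec.Omega) :
    0 < U.soundSpeedSq k eos ↔ (eos k).pInf < U.ρ k * U.e k :=
  h.soundSpeedSq_pos_iff (U.rho_pos hU k) (U.e_pos hU k)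

end BaerNunziato

end

/-! ### Positivity, conservativity and entropy inequalities of the scheme -/

open BaerNunziato in
theorem mainTheorem1 (eos : Fin 2 → PhaseEOS) (Δt Δx : ℝ) (hΔt : 0 < Δt) (hΔx : 0 < Δx)
    (a : ℕ → ℤ → Fin 2 → ℝ) (ha : ∀ n j k, 0 < a n j k)
    (R : ℕ → ℤ → RiemannFan) (U : ℕ → ℤ → BNVec) (hU : IsScheme eos Δt Δx a R U)
    (n : ℕ)
    (hR : ∀ j, IsSubsonicSolution eos (a n j) (equilibrium eos (U n j))
      (equilibrium eos (U n (j + 1))) (R n j)) :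
    -- positivity of phase fractions and partial masses
    ((∀ j, U n j ∈ BNVec.Omega) → CFL Δt Δx (a n) (U n) →
      ∀ j k, 0 < (U (n + 1) j).α k ∧ (U (n + 1) j).α k < 1 ∧ 0 < (U (n + 1) j).mass k) ∧
    -- positivity of the internal energies
    ((∀ j, U n j ∈ BNVec.Omega) → (∀ j k, (eos k).pInf < (U n j).ρ k * (U n j).e k) →
      CFL Δt Δx (a n) (U n) → (∀ j, Whitham eos (a n j) (R n j)) →
      ∀ j, U (n + 1) j ∈ BNVec.Omega ∧
        ∀ k, 0 < (U (n + 1) j).e k ∧ (eos k).pInf < (U (n + 1) j).ρ k * (U (n + 1) j).e k) ∧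
    -- real sound speeds for ideal and stiffened gases
    (∀ k, (eos k).IsStiffenedGas → (∀ j, U n j ∈ BNVec.Omega) →
      (∀ i, i ≠ k → ∀ j, (eos i).pInf < (U n j).ρ i * (U n j).e i) →
      CFL Δt Δx (a n) (U n) → (∀ j, Whitham eos (a n j) (R n j)) →
      (∀ j, 0 < (U n j).soundSpeedSq k eos) → ∀ j, 0 < (U (n + 1) j).soundSpeedSq k eos) ∧
    -- conservativity: partial masses, total momentum, total energy
    (∀ k, IsConservativeUpdate (Δt / Δx)
      (fun j => (U n j).mass k) (fun j => (U (n + 1) j).mass k)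
      (fun j => (fluxMinus eos (a n j) (R n j) (U n j) (U n (j + 1))).mass k)
      (fun j => (fluxPlus eos (a n j) (R n j) (U n j) (U n (j + 1))).mass k)) ∧
    IsConservativeUpdate (Δt / Δx)
      (fun j => ∑ k, (U n j).mom k) (fun j => ∑ k, (U (n + 1) j).mom k)
      (fun j => ∑ k, (fluxMinus eos (a n j) (R n j) (U n j) (U n (j + 1))).mom k)
      (fun j => ∑ k, (fluxPlus eos (a n j) (R n j) (U n j) (U n (j + 1))).mom k) ∧
    IsConservativeUpdate (Δt / Δx)
      (fun j => ∑ k, (U n j).ener k) (fun j => ∑ k, (U (n + 1) j).ener k)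
      (fun j => ∑ k, (fluxMinus eos (a n j) (R n j) (U n j) (U n (j + 1))).ener k)
      (fun j => ∑ k, (fluxPlus eos (a n j) (R n j) (U n j) (U n (j + 1))).ener k) ∧
    -- discrete entropy inequalities, the entropy fluxes being the same from both sides
    ((∀ j, U n j ∈ BNVec.Omega) → (∀ j k, (eos k).pInf < (U n j).ρ k * (U n j).e k) →
      CFL Δt Δx (a n) (U n) → (∀ j, Whitham eos (a n j) (R n j)) →
      ∀ k j, ((R n j).evalLeft 0).entFlux k = ((R n j).eval 0).entFlux k ∧
        (U (n + 1) j).entropy k eos ≤ (U n j).entropy k eos - Δt / Δx *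
          (((R n j).eval 0).entFlux k - ((R n (j - 1)).eval 0).entFlux k)) := by
  have hr : 0 < Δt / Δx := div_pos hΔt hΔx
  have step : (∀ j, U n j ∈ BNVec.Omega) → CFL Δt Δx (a n) (U n) → ∀ j,
      CellStep eos (Δt / Δx) (a n (j - 1)) (a n j) (R n (j - 1)) (R n j) (U n (j - 1)) (U n j)
        (U n (j + 1)) := by
    intro hΩ hC j
    have hl := hR (j - 1)
    have hhl := hC.halfCell hr hl
    rw [sub_add_cancel] at hl hhl
    exact ⟨hr, ha n _, ha n _, hl, hR j, hhl, hC.halfCell hr (hR j), hΩ _, hΩ _, hΩ _⟩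
  have hnext : ∀ j, U (n + 1) j = nextState eos (Δt / Δx) (a n (j - 1)) (a n j) (R n (j - 1))
      (R n j) (U n (j - 1)) (U n j) (U n (j + 1)) := hU n
  have main : (∀ j, U n j ∈ BNVec.Omega) → (∀ j k, (eos k).pInf < (U n j).ρ k * (U n j).e k) →
      CFL Δt Δx (a n) (U n) → (∀ j, Whitham eos (a n j) (R n j)) → ∀ j,
      U (n + 1) j ∈ BNVec.Omega ∧ ∀ k, (eos k).pInf < (U (n + 1) j).ρ k * (U (n + 1) j).e k ∧
        (U (n + 1) j).entropy k eos ≤ (U n j).entropy k eos - Δt / Δx *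
          (((R n j).eval 0).entFlux k - ((R n (j - 1)).eval 0).entFlux k) := by
    intro hΩ hadm hC hW j
    have hk := fun k => (step hΩ hC j).admissible_and_entropy k (hadm _ k) (hadm _ k) (hadm _ k)
      (hW _) (hW _)
    rw [hnext j]
    exact ⟨(step hΩ hC j).next_mem_Omega fun k => (hk k).1, hk⟩
  refine ⟨?_, ?_, ?_, ?_, ?_, ?_, ?_⟩
  · intro hΩ hC j k
    have hpos := (step hΩ hC j).alpha_pos
    rw [← hnext j] at hpos
    refine ⟨hpos k, ?_, hnext j ▸ (step hΩ hC j).mass_pos k⟩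
    have h0 := hpos 0
    have h1 := hpos 1
    fin_cases k <;> simp [BNVec.α, frac] at h0 h1 ⊢ <;> linarith
  · intro hΩ hadm hC hW j
    obtain ⟨h1, h2⟩ := main hΩ hadm hC hW j
    exact ⟨h1, fun k => ⟨BNVec.e_pos h1 k, (h2 k).1⟩⟩
  · intro k hk hΩ hadm hC hW hc j
    -- For phase `k` admissibility is read off from the positive squared sound speed.
    have hadm' : ∀ j i, (eos i).pInf < (U n j).ρ i * (U n j).e i := by
      intro j i
      by_cases hi : i = k
      · subst hi
        exact (soundSpeedSq_pos_iff hk (hΩ j)).1 (hc j)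
      · exact hadm i hi j
    obtain ⟨h1, h2⟩ := main hΩ hadm' hC hW j
    exact (soundSpeedSq_pos_iff hk h1).2 (h2 k).1
  · refine fun k => isConservativeUpdate_of_scheme (fun j => fluxMinus_mass_eq (hR j) k) fun j => ?_
    simp only [hU n j, BNVec.update, sub_add_cancel]
  · refine isConservativeUpdate_of_scheme (fun j => sum_fluxMinus_mom_eq (hR j)) fun j => ?_
    simp only [hU n j, BNVec.update, sub_add_cancel, Finset.sum_sub_distrib, ← Finset.mul_sum]
  · refine isConservativeUpdate_of_scheme (fun j => sum_fluxMinus_ener_eq _ _ _ _ _) fun j => ?_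
    simp only [hU n j, BNVec.update, sub_add_cancel, Finset.sum_sub_distrib, ← Finset.mul_sum]
  · intro hΩ hadm hC hW k j
    refine ⟨?_, ((main hΩ hadm hC hW j).2 k).2⟩
    have := (R n j).rankineHugoniot (F := fun W => W.mass k * W.s k) (G := fun W => W.entFlux k)
      ((hR j).ent_eq k) 0
    simp only [zero_mul, sub_zero, ite_self] at this
    exact (sub_eq_zero.1 this).symm
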